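/- Call a triangle in the Euclidean plane an $H$-triangle if one of its sides is parallel to the $x$-axis. A trigon made of $n$ equilateral $H$-triangles of side $s$ is a union of $n$ closed equilateral $H$-triangles of side $s$ with pairwise disjoint interiors that is connected through matching edges: any two of the $n$ triangles are joined by a chain of triangles among them in which consecutive ones have a whole side in common. Let $n\ge 1$ be an integer. (1) There is $\varepsilon_0>0$, depending only on $n$, such that for every $0<\varepsilon<\varepsilon_0$ and every equilateral $H$-triangle $T$ of side $n+\varepsilon$, the minimum number of unit equilateral $H$-triangles required to cover $T$ is exactly $n^2+2$. (2) There is $\varepsilon_0>0$, depending only on $n$, such that for every $0<\varepsilon<\varepsilon_0$ and every trigon $X$ made of $n$ equilateral $H$-triangles of side $1+\varepsilon$, the minimum number of unit equilateral $H$-triangles required to cover $X$ is exactly $n+2$. -/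

import Mathlib

/-- The Euclidean plane; coordinate `0` is `x`, coordinate `1` is `y`. -/
abbrev Plane : Type := EuclideanSpace ℝ (Fin 2)

/-- An `H`-triangle: a (nondegenerate) triangle with one side parallel to the `x`-axis. -/
def IsHTriangle (T : Affine.Triangle ℝ Plane) : Prop :=
  ∃ i j : Fin 3, i ≠ j ∧ T.points i 1 = T.points j 1

/-- `T` is an equilateral `H`-triangle all of whose sides have length `s`. -/
def IsEquilateralHTriangle (s : ℝ) (T : Affine.Triangle ℝ Plane) : Prop :=
  IsHTriangle T ∧ ∀ i j : Fin 3, i ≠ j → dist (T.points i) (T.points j) = s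

/-- The two triangles have a whole side in common (two common vertices). -/
def ShareSide (T T' : Affine.Triangle ℝ Plane) : Prop :=
  ∃ p q : Plane, p ≠ q ∧
    p ∈ Set.range T.points ∧ q ∈ Set.range T.points ∧
    p ∈ Set.range T'.points ∧ q ∈ Set.range T'.points

/-- `X` is a trigon made of `n` equilateral `H`-triangles of side `s`: the union of `n` such
(closed) triangles with pairwise disjoint interiors, connected through common sides, that is, any
two of them are joined by a chain in which consecutive triangles have a whole side in common. -/
def IsTrigon (n : ℕ) (s : ℝ) (X : Set Plane) : Prop :=
  ∃ T : Fin n → Affine.Triangle ℝ Plane,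
    (∀ i, IsEquilateralHTriangle s (T i)) ∧
    (∀ i j, i ≠ j → Disjoint (interior (T i).closedInterior) (interior (T j).closedInterior)) ∧
    (SimpleGraph.fromRel fun i j => ShareSide (T i) (T j)).Connected ∧
    X = ⋃ i, (T i).closedInterior

/-- `X` can be covered by `k` (closed) unit equilateral `H`-triangles. -/
def CoverableByUnit (k : ℕ) (X : Set Plane) : Prop :=
  ∃ T : Fin k → Affine.Triangle ℝ Plane,
    (∀ i, IsEquilateralHTriangle 1 (T i)) ∧ X ⊆ ⋃ i, (T i).closedInterior

/-- `N` is the minimum number of unit equilateral `H`-triangles required to cover `X`. -/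
def IsUnitCoverNumber (X : Set Plane) (N : ℕ) : Prop :=
  IsLeast {k : ℕ | CoverableByUnit k X} N

/-! Linear coordinates turn equilateral `H`-triangles of side `s` into right triangles with legs `s`
parallel to the axes and an orientation `σ = ±1`. Since a triangle of side `n + ε` splits into `n ^
2` cells of side `1 + ε / n` forming a trigon, (1) follows from the argument for (2).

Lower bound. Let `s > 1` be the side of the `N` triangles of a trigon. Their bases lie on horizontal
lines spaced `s` apart. Slice by the lines at phase `τ`, again spaced `s` apart. Divided by `s`, the
total length inside a triangle of the trigon is a sawtooth `Int.fract (± τ)`; a unit triangle meets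
at most one line up to null length and contributes a shifted sawtooth lowered by `η = 1 - 1 / s` and
cut at `0`. If `N + 1` unit triangles sufficed, let `G` be the sum of their `N + 1` uncut sawtooths
minus the `N` sawtooths of the trigon. Then `G ≥ 0`, and modulo `1` it is affine with slope an
integer `m`, odd by parity, hence nonzero. So `G` dominates `Int.fract (m * τ + C)`; both have
integral `1 / 2` over a period, hence they agree almost everywhere. On the side of a zero of `m * τ
+ C` where `G` is small, the margin left by the truncation forces all `N + 1` sawtooths to start
from `0` there. Just across it they are all near `1`, while the `N` sawtooths of the trigon, which
has both orientations, sum to at most `N - 1`; so `G > 1` there, a contradiction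
(`not_sum_fract_le_sum_truncated`). A single triangle is handled by its three vertices.

Upper bound. Three unit triangles cover one slightly enlarged triangle. Each further triangle of the
trigon costs one unit triangle, placed at the vertex opposite the common side; the strip left over
lies in a slight enlargement of the neighbour (`SideAdjacent.exists_enlargedTriangle_subset`). -/

/-! ### Sums of sawtooth functions -/

theorem intervalIntegrable_fract_affine (k c a b : ℝ) :
    IntervalIntegrable (fun x : ℝ => Int.fract (k * x + c)) MeasureTheory.volume a b := by
  have hm : Measurable fun x : ℝ => Int.fract (k * x + c) := by fun_prop
  refine (intervalIntegrable_const (c := (1 : ℝ))).mono_fun hm.aestronglyMeasurable ?_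
  refine Filter.Eventually.of_forall fun x => ?_
  simp [abs_of_nonneg, Int.fract_nonneg, (Int.fract_lt_one _).le]

open MeasureTheory Filter Set in
theorem integral_fract_affine (k : ℤ) (hk : k ≠ 0) (c t : ℝ) :
    ∫ x in t..t + 1, Int.fract (k * x + c) = 1 / 2 := by
  have hk' : (k : ℝ) ≠ 0 := by exact_mod_cast hk
  have hper : Function.Periodic (Int.fract : ℝ → ℝ) 1 := fun x => Int.fract_add_one x
  have h01 : ∫ x in (0 : ℝ)..0 + 1, Int.fract x = 1 / 2 := by
    have : ∫ x in (0 : ℝ)..0 + 1, Int.fract x = ∫ x in (0 : ℝ)..0 + 1, x := by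
      apply intervalIntegral.integral_congr_ae
      have h1 : ∀ᵐ x : ℝ, x ≠ 1 := Measure.ae_ne volume 1
      filter_upwards [h1] with x hx hxm
      rw [uIoc_of_le (by norm_num)] at hxm
      rw [Int.fract_eq_self]
      refine ⟨hxm.1.le, lt_of_le_of_ne (by linarith [hxm.2]) hx⟩
    rw [this, integral_id]; norm_num
  rw [intervalIntegral.integral_comp_mul_add _ hk']
  have : (k : ℝ) * (t + 1) + c = (k * t + c) + k • (1 : ℝ) := by simp; ring
  rw [this, hper.intervalIntegral_add_zsmul_eq, hper.intervalIntegral_add_eq _ 0, h01]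
  · simp only [smul_eq_mul, zsmul_eq_mul]
    field_simp
  · intro a b
    simpa using intervalIntegrable_fract_affine 1 0 a b

open MeasureTheory Filter Set in
theorem exists_mem_Ioo_of_ae {P : ℝ → Prop} (h : ∀ᵐ x, P x) {a b : ℝ} (hab : a < b) :
    ∃ x ∈ Ioo a b, P x := by
  obtain ⟨x, hx, hx'⟩ := (Measure.dense_of_ae h).exists_between hab
  exact ⟨x, hx', hx⟩

-- Moving off `x`, the fractional part stays near `Int.fract x` if that is positive, and drops to
-- near `1` if it is zero and the motion is to the left. Only a motion to the right from an integer
-- keeps it of order `r`.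
open Filter Topology in
theorem eventually_fract_le_imp (x M : ℝ) (e : ℤˣ) :
    ∀ᶠ r in 𝓝[>] (0 : ℝ), Int.fract (x + (e : ℤ) * r) ≤ M * r → e = 1 ∧ Int.fract x = 0 := by
  have h0 := Int.fract_nonneg x
  have h1 := Int.fract_lt_one x
  have small : ∀ d : ℝ, 0 < d → ∀ᶠ r in 𝓝[>] (0 : ℝ), r < d := fun d hd =>
    nhdsWithin_le_nhds (Iio_mem_nhds hd)
  have smallM : ∀ d : ℝ, 0 < d → ∀ᶠ r in 𝓝[>] (0 : ℝ), (|M| + 1) * r < d := fun d hd => by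
    have hM : 0 < |M| + 1 := by positivity
    filter_upwards [small (d / (|M| + 1)) (by positivity)] with r hr
    rwa [lt_div_iff₀' hM] at hr
  have key : ∀ r : ℝ, 0 < r → M * r ≤ |M| * r := fun r hr =>
    mul_le_mul_of_nonneg_right (le_abs_self M) hr.le
  have hx : x = ⌊x⌋ + Int.fract x := (Int.floor_add_fract x).symm
  have pos : ∀ᶠ r in 𝓝[>] (0 : ℝ), 0 < r := self_mem_nhdsWithin
  rcases Int.units_eq_one_or e with rfl | rfl
  · rcases h0.eq_or_lt with h | h
    · exact Eventually.of_forall fun r _ => ⟨rfl, h.symm⟩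
    · filter_upwards [small (1 - Int.fract x) (by linarith), smallM _ h, pos] with r hr1 hr2 hr hle
      exfalso
      have : Int.fract (x + ((1 : ℤˣ) : ℤ) * r) = Int.fract x + r := by
        rw [Int.fract_eq_iff]
        refine ⟨by linarith, by linarith, ⌊x⌋, ?_⟩
        push_cast
        linarith
      nlinarith [key r hr]
  · rcases h0.eq_or_lt with h | h
    · filter_upwards [small 1 one_pos, smallM 1 one_pos, pos] with r hr1 hr2 hr hle
      exfalso
      have : Int.fract (x + ((-1 : ℤˣ) : ℤ) * r) = 1 - r := by
        rw [Int.fract_eq_iff]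
        refine ⟨by linarith, by linarith, ⌊x⌋ - 1, ?_⟩
        push_cast
        linarith
      nlinarith [key r hr]
    · filter_upwards [small _ h, smallM _ h, pos] with r hr1 hr2 hr hle
      exfalso
      have : Int.fract (x + ((-1 : ℤˣ) : ℤ) * r) = Int.fract x - r := by
        rw [Int.fract_eq_iff]
        refine ⟨by linarith, by linarith, ⌊x⌋, ?_⟩
        push_cast
        linarith
      nlinarith [key r hr]

/-- Every unit is odd and the total number of terms is odd, so the difference is odd. -/
theorem sum_units_sub_sum_units_ne_zero {ι κ : Type*} [Fintype ι] [Fintype κ]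
    (hcard : Fintype.card ι = Fintype.card κ + 1) (σ : ι → ℤˣ) (ρ : κ → ℤˣ) :
    (∑ i, (σ i : ℤ) - ∑ j, (ρ j : ℤ)) ≠ 0 := by
  intro h
  have hu : ∀ u : ℤˣ, (((u : ℤ)) : ZMod 2) = 1 := by
    intro u
    rcases Int.units_eq_one_or u with rfl | rfl <;> decide
  have h2 := congrArg (Int.cast : ℤ → ZMod 2) h
  push_cast at h2
  simp [hu, hcard] at h2

/-- Two opposite sawtooths together contribute at most `1`, every other one at most `1`. -/
theorem sum_fract_units_le {κ : Type*} [Fintype κ] [DecidableEq κ] (ρ : κ → ℤˣ) {p q : κ}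
    (hp : ρ p = 1) (hq : ρ q = -1) (τ : ℝ) :
    ∑ j, Int.fract ((ρ j : ℤ) * τ) ≤ (Fintype.card κ : ℝ) - 1 := by
  have hpq : p ≠ q := by
    rintro rfl
    rw [hp] at hq
    exact absurd hq (by decide)
  have hle : ∑ j, (1 - Int.fract ((ρ j : ℤ) * τ)) ≥
      ∑ j ∈ {p, q}, (1 - Int.fract ((ρ j : ℤ) * τ)) :=
    Finset.sum_le_sum_of_subset_of_nonneg (Finset.subset_univ _)
      fun j _ _ => by linarith [Int.fract_lt_one (((ρ j : ℤ) : ℝ) * τ)]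
  rw [Finset.sum_pair hpq, hp, hq, Finset.sum_sub_distrib] at hle
  simp only [Finset.sum_const, Finset.card_univ, nsmul_eq_mul, mul_one, Units.val_one,
    Units.val_neg, Int.cast_one, Int.cast_neg, one_mul, neg_mul] at hle
  have : Int.fract τ + Int.fract (-τ) ≤ 1 := by
    by_cases h : Int.fract τ = 0
    · rw [h]; linarith [Int.fract_lt_one (-τ)]
    · rw [Int.fract_neg h]; linarith
  linarith

open MeasureTheory Filter Set Topology in
/-- A sum of `n` sawtooth functions with integral zeros and of both orientations is not
dominated by `n + 1` truncated sawtooth functions. -/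
theorem not_sum_fract_le_sum_truncated {ι κ : Type*} [Fintype ι] [Fintype κ]
    (hcard : Fintype.card ι = Fintype.card κ + 1) (σ : ι → ℤˣ) (ρ : κ → ℤˣ) (c : ι → ℝ)
    {η : ℝ} (hη : 0 < η) {p q : κ} (hp : ρ p = 1) (hq : ρ q = -1)
    (h : ∀ᵐ τ : ℝ, ∑ j, Int.fract ((ρ j : ℤ) * τ) ≤
      ∑ i, max 0 (Int.fract ((σ i : ℤ) * (τ - c i)) - η)) : False := by
  classical
  set m : ℤ := ∑ i, (σ i : ℤ) - ∑ j, (ρ j : ℤ) with hm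
  have hm0 : m ≠ 0 := sum_units_sub_sum_units_ne_zero hcard σ ρ
  have hmR : (m : ℝ) ≠ 0 := by exact_mod_cast hm0
  set C : ℝ := -∑ i, (σ i : ℤ) * c i with hC
  set G : ℝ → ℝ := fun τ => ∑ i, Int.fract ((σ i : ℤ) * (τ - c i)) -
    ∑ j, Int.fract ((ρ j : ℤ) * τ) with hG
  have hG_ge : ∀ᵐ τ : ℝ, ∑ i, min (Int.fract ((σ i : ℤ) * (τ - c i))) η ≤ G τ := by
    filter_upwards [h] with τ hτ
    have : ∀ i, max 0 (Int.fract (((σ i : ℤ) : ℝ) * (τ - c i)) - η) =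
        Int.fract ((σ i : ℤ) * (τ - c i)) - min (Int.fract ((σ i : ℤ) * (τ - c i))) η := by
      intro i
      rcases le_total (Int.fract (((σ i : ℤ) : ℝ) * (τ - c i))) η with h | h
      · rw [min_eq_left h, max_eq_left (by linarith)]; ring
      · rw [min_eq_right h, max_eq_right (by linarith)]
    simp only [this, Finset.sum_sub_distrib] at hτ
    simp only [hG]
    linarith
  have hmin0 : ∀ τ i, 0 ≤ min (Int.fract (((σ i : ℤ) : ℝ) * (τ - c i))) η := fun τ i =>
    le_min (Int.fract_nonneg _) hη.le
  have hG0 : ∀ᵐ τ : ℝ, 0 ≤ G τ := by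
    filter_upwards [hG_ge] with τ hτ
    exact (Finset.sum_nonneg fun i _ => hmin0 τ i).trans hτ
  -- Dropping the integer parts makes `G` affine modulo `1`.
  have hfr : ∀ τ, Int.fract (G τ) = Int.fract (m * τ + C) := by
    intro τ
    rw [Int.fract_eq_fract]
    refine ⟨∑ j, ⌊((ρ j : ℤ) : ℝ) * τ⌋ - ∑ i, ⌊((σ i : ℤ) : ℝ) * (τ - c i)⌋, ?_⟩
    simp only [hG, hm, hC, Int.fract, Finset.sum_sub_distrib, mul_sub, Int.cast_sub,
      Int.cast_sum, sub_mul, Finset.sum_mul]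
    ring
  have hle : ∀ᵐ τ : ℝ, 0 ≤ G τ - Int.fract (m * τ + C) := by
    filter_upwards [hG0] with τ hτ
    rw [← hfr]
    have : (0 : ℝ) ≤ ⌊G τ⌋ := by exact_mod_cast Int.floor_nonneg.2 hτ
    linarith [Int.floor_add_fract (G τ)]
  have hu0 : ∀ u : ℤˣ, (u : ℤ) ≠ 0 := fun u => u.ne_zero
  have hre : ∀ i τ, Int.fract (((σ i : ℤ) : ℝ) * (τ - c i)) =
      Int.fract ((σ i : ℤ) * τ + (-((σ i : ℤ) * c i))) := fun i τ => by congr 1; ring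
  have hre' : ∀ j τ, Int.fract (((ρ j : ℤ) : ℝ) * τ) = Int.fract ((ρ j : ℤ) * τ + 0) :=
    fun j τ => by simp
  set τ₀ : ℝ := -C / m with hτ₀
  set t : ℝ := τ₀ - 1 / 2 with ht
  have hintσ : IntervalIntegrable (fun τ => ∑ i, Int.fract (((σ i : ℤ) : ℝ) * (τ - c i)))
      volume t (t + 1) := by
    have := IntervalIntegrable.sum Finset.univ fun i _ =>
      intervalIntegrable_fract_affine (σ i : ℤ) (-((σ i : ℤ) * c i)) t (t + 1)
    simpa only [Finset.sum_fn, ← hre] using this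
  have hintρ : IntervalIntegrable (fun τ => ∑ j, Int.fract (((ρ j : ℤ) : ℝ) * τ))
      volume t (t + 1) := by
    have := IntervalIntegrable.sum Finset.univ fun j _ =>
      intervalIntegrable_fract_affine (ρ j : ℤ) 0 t (t + 1)
    simpa only [Finset.sum_fn, ← hre'] using this
  have hint1 : IntervalIntegrable G volume t (t + 1) := hintσ.sub hintρ
  have hint2 := intervalIntegrable_fract_affine m C t (t + 1)
  have hIG : ∫ τ in t..t + 1, G τ = 1 / 2 := by
    simp only [hG]
    rw [intervalIntegral.integral_sub, intervalIntegral.integral_finsetSum,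
      intervalIntegral.integral_finsetSum]
    · simp only [hre, hre', integral_fract_affine _ (hu0 _), Finset.sum_const, Finset.card_univ,
        hcard, nsmul_eq_mul]
      push_cast; ring
    · intro j _; simp only [hre']; exact intervalIntegrable_fract_affine _ _ _ _
    · intro i _; simp only [hre]; exact intervalIntegrable_fract_affine _ _ _ _
    · exact hintσ
    · exact hintρ
  -- A nonnegative function with zero integral: equality holds almost everywhere on a period centred
  -- at the zero `τ₀` of `m * τ + C`.
  have hzero : ∫ τ in t..t + 1, (G τ - Int.fract (m * τ + C)) = 0 := by
    rw [intervalIntegral.integral_sub hint1 hint2, hIG, integral_fract_affine m hm0]; ring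
  rw [intervalIntegral.integral_of_le (by linarith),
    integral_eq_zero_iff_of_nonneg_ae (ae_restrict_of_ae hle) (hint1.sub hint2).1] at hzero
  have hae : ∀ᵐ τ : ℝ, τ ∈ Ioc t (t + 1) →
      G τ = Int.fract (m * τ + C) ∧ ∑ i, min (Int.fract ((σ i : ℤ) * (τ - c i))) η ≤ G τ := by
    rw [Filter.EventuallyEq, ae_restrict_iff' measurableSet_Ioc] at hzero
    filter_upwards [hzero, hG_ge] with τ h1 h2 h3
    exact ⟨by have := h1 h3; simp only [Pi.zero_apply] at this; linarith, h2⟩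
  have hshift : ∀ e : ℤˣ, ∀ᵐ r : ℝ, τ₀ + (e : ℤ) * r ∈ Ioc t (t + 1) →
      G (τ₀ + (e : ℤ) * r) = Int.fract (m * (τ₀ + (e : ℤ) * r) + C) ∧
      ∑ i, min (Int.fract ((σ i : ℤ) * (τ₀ + (e : ℤ) * r - c i))) η ≤ G (τ₀ + (e : ℤ) * r) := by
    intro e
    rcases Int.units_eq_one_or e with rfl | rfl
    · simpa using (measurePreserving_add_left volume τ₀).quasiMeasurePreserving.ae hae
    · simpa [sub_eq_add_neg] using
        (Measure.measurePreserving_sub_left volume τ₀).quasiMeasurePreserving.ae hae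
  have hIoc : ∀ (e : ℤˣ) (r : ℝ), 0 < r → r < 1 / 2 → τ₀ + (e : ℤ) * r ∈ Ioc t (t + 1) := by
    intro e r h1 h2
    rcases Int.units_eq_one_or e with rfl | rfl <;> simp [ht] <;> constructor <;> linarith
  have hmτ : (m : ℝ) * τ₀ + C = 0 := by rw [hτ₀]; field_simp; ring
  -- `e` is the direction in which `m * τ + C` increases from `0`.
  obtain ⟨e, he⟩ : ∃ e : ℤˣ, (m : ℝ) * (e : ℤ) = |(m : ℝ)| := by
    rcases le_total 0 (m : ℝ) with h | h
    · exact ⟨1, by simp [abs_of_nonneg h]⟩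
    · exact ⟨-1, by simp [abs_of_nonpos h]⟩
  have habs : 0 < |(m : ℝ)| := abs_pos.2 hmR
  have hev : ∀ᶠ r in 𝓝[>] (0 : ℝ), ∀ i,
      Int.fract ((σ i : ℤ) * (τ₀ - c i) + ((σ i * e : ℤˣ) : ℤ) * r) ≤ |(m : ℝ)| * r →
        σ i * e = 1 ∧ Int.fract (((σ i : ℤ) : ℝ) * (τ₀ - c i)) = 0 :=
    eventually_all.2 fun i => eventually_fract_le_imp _ _ _
  have hev2 : ∀ᶠ r in 𝓝[>] (0 : ℝ), |(m : ℝ)| * r < min 1 η := by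
    have : Tendsto (fun r : ℝ => |(m : ℝ)| * r) (𝓝[>] 0) (𝓝 0) := by
      have h : Tendsto (fun r : ℝ => |(m : ℝ)| * r) (𝓝 0) (𝓝 (|(m : ℝ)| * 0)) :=
        (continuous_const.mul continuous_id).tendsto 0
      rw [mul_zero] at h
      exact h.mono_left nhdsWithin_le_nhds
    exact this.eventually (gt_mem_nhds (lt_min one_pos hη))
  obtain ⟨δ, hδ, hsub⟩ := mem_nhdsGT_iff_exists_Ioo_subset.1 (hev.and hev2)
  have hδ0 : (0 : ℝ) < δ := hδ
  obtain ⟨r, hr, hPr⟩ := exists_mem_Ioo_of_ae (hshift e)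
    (show (0 : ℝ) < min δ (1 / 2) from lt_min hδ0 (by norm_num))
  obtain ⟨hr1, hr2⟩ := hsub ⟨hr.1, hr.2.trans_le (min_le_left _ _)⟩
  obtain ⟨hGr, hGm⟩ := hPr (hIoc e r hr.1 (hr.2.trans_le (min_le_right _ _)))
  have hval : (m : ℝ) * (τ₀ + (e : ℤ) * r) + C = |(m : ℝ)| * r := by
    rw [← he]; linear_combination hmτ
  rw [hGr, hval, Int.fract_eq_self.2
    ⟨(mul_pos habs hr.1).le, hr2.trans_le (min_le_left _ _)⟩] at hGm
  -- Each truncated term is at most `G = |m| * r < η`, so the minimum is the fractional part itself.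
  have hall : ∀ i, σ i * e = 1 ∧ Int.fract (((σ i : ℤ) : ℝ) * (τ₀ - c i)) = 0 := by
    intro i
    apply hr1 i
    have h1 := (Finset.single_le_sum (fun i _ => hmin0 (τ₀ + (e : ℤ) * r) i)
      (Finset.mem_univ i)).trans hGm
    rcases min_le_iff.1 h1 with h2 | h2
    · refine le_of_eq_of_le (congrArg _ ?_) h2
      push_cast
      ring
    · linarith [hr2.trans_le (min_le_right _ _)]
  have hN : (0 : ℝ) < Fintype.card ι := by rw [hcard]; positivity
  have hN' : (0 : ℝ) < min (1 / (Fintype.card ι : ℝ)) (1 / 2) :=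
    lt_min (one_div_pos.2 hN) (by norm_num)
  -- On the other side of `τ₀`, with `N` the cardinality of `κ`, `G ≥ (N + 1) * (1 - r') - (N - 1) =
  -- 2 - (N + 1) * r'`, which exceeds `1` once `r' < 1 / (N + 1)`.
  obtain ⟨r', hr', hPr'⟩ := exists_mem_Ioo_of_ae (hshift (-e)) hN'
  obtain ⟨hG', -⟩ := hPr' (hIoc (-e) r' hr'.1 (hr'.2.trans_le (min_le_right _ _)))
  have hlt1 : G (τ₀ + ((-e : ℤˣ) : ℤ) * r') < 1 := hG'.trans_lt (Int.fract_lt_one _)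
  have hfi : ∀ i, Int.fract (((σ i : ℤ) : ℝ) * (τ₀ + ((-e : ℤˣ) : ℤ) * r' - c i)) = 1 - r' := by
    intro i
    obtain ⟨h1, h2⟩ := hall i
    have h3 : (((σ i : ℤ) : ℝ) * ((e : ℤ) : ℝ)) = 1 := by
      simpa using congrArg (fun u : ℤˣ => ((u : ℤ) : ℝ)) h1
    rw [Int.fract_eq_iff]
    have hr'2 := hr'.2.trans_le (min_le_right _ _)
    have hr'1 := hr'.1
    refine ⟨by linarith, by linarith, ⌊((σ i : ℤ) : ℝ) * (τ₀ - c i)⌋ - 1, ?_⟩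
    have h4 := Int.floor_add_fract (((σ i : ℤ) : ℝ) * (τ₀ - c i))
    push_cast
    linear_combination -h4 + h2 - r' * h3
  have hκ := sum_fract_units_le ρ hp hq (τ₀ + ((-e : ℤˣ) : ℤ) * r')
  simp only [hG, hfi, Finset.sum_const, Finset.card_univ, nsmul_eq_mul] at hlt1
  have hr'3 := hr'.2.trans_le (min_le_left _ _)
  rw [lt_div_iff₀' hN] at hr'3
  rw [hcard] at hlt1 hr'3
  push_cast at hlt1 hr'3 hκ
  linarith

/-! ### Slicing triangles by horizontal lines -/

/-- In oblique coordinates, the closed triangle with vertices `(x, y)`, `(x + σ s, y)` and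
`(x, y + σ s)`. -/
def obliqueTriangle (σ : ℤˣ) (s x y : ℝ) : Set (ℝ × ℝ) :=
  {q | 0 ≤ ((σ : ℤ) : ℝ) * (q.1 - x) ∧ 0 ≤ ((σ : ℤ) : ℝ) * (q.2 - y) ∧
    ((σ : ℤ) : ℝ) * (q.1 - x) + ((σ : ℤ) : ℝ) * (q.2 - y) ≤ s}

/-- The open triangle with the same vertices as `obliqueTriangle σ s x y`. -/
def openObliqueTriangle (σ : ℤˣ) (s x y : ℝ) : Set (ℝ × ℝ) :=
  {q | 0 < ((σ : ℤ) : ℝ) * (q.1 - x) ∧ 0 < ((σ : ℤ) : ℝ) * (q.2 - y) ∧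
    ((σ : ℤ) : ℝ) * (q.1 - x) + ((σ : ℤ) : ℝ) * (q.2 - y) < s}

theorem openObliqueTriangle_subset (σ : ℤˣ) (s x y : ℝ) :
    openObliqueTriangle σ s x y ⊆ obliqueTriangle σ s x y :=
  fun _ h => ⟨h.1.le, h.2.1.le, h.2.2.le⟩

theorem measurableSet_obliqueTriangle (σ : ℤˣ) (s x y : ℝ) :
    MeasurableSet (obliqueTriangle σ s x y) := by
  have h1 : Measurable fun q : ℝ × ℝ => ((σ : ℤ) : ℝ) * (q.1 - x) := by fun_prop
  have h2 : Measurable fun q : ℝ × ℝ => ((σ : ℤ) : ℝ) * (q.2 - y) := by fun_prop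
  exact (measurableSet_le measurable_const h1).inter
    ((measurableSet_le measurable_const h2).inter (measurableSet_le (h1.add h2) measurable_const))

theorem isOpen_openObliqueTriangle (σ : ℤˣ) (s x y : ℝ) :
    IsOpen (openObliqueTriangle σ s x y) := by
  have h1 : Continuous fun q : ℝ × ℝ => ((σ : ℤ) : ℝ) * (q.1 - x) := by fun_prop
  have h2 : Continuous fun q : ℝ × ℝ => ((σ : ℤ) : ℝ) * (q.2 - y) := by fun_prop
  exact (isOpen_lt continuous_const h1).inter
    ((isOpen_lt continuous_const h2).inter (isOpen_lt (h1.add h2) continuous_const))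

open MeasureTheory Set in
theorem volume_slice_obliqueTriangle_le (σ : ℤˣ) (s x y Y : ℝ) :
    volume {t : ℝ | (t, Y) ∈ obliqueTriangle σ s x y} ≤
      if 0 ≤ ((σ : ℤ) : ℝ) * (Y - y) then ENNReal.ofReal (s - ((σ : ℤ) : ℝ) * (Y - y)) else 0 := by
  split_ifs with h
  · rcases Int.units_eq_one_or σ with rfl | rfl
    · refine (measure_mono (t := Icc x (x + (s - (Y - y)))) ?_).trans ?_
      · rintro t ⟨h1, -, h3⟩
        simp only [Units.val_one, Int.cast_one, one_mul] at h1 h3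
        exact ⟨by linarith, by linarith⟩
      · rw [Real.volume_Icc]
        simp
    · refine (measure_mono (t := Icc (x - (s + (Y - y))) x) ?_).trans ?_
      · rintro t ⟨h1, -, h3⟩
        simp only [Units.val_neg, Units.val_one, Int.cast_neg, Int.cast_one] at h1 h3
        exact ⟨by linarith, by linarith⟩
      · rw [Real.volume_Icc]
        exact ENNReal.ofReal_le_ofReal (by push_cast; linarith)
  · refine le_of_eq ?_
    rw [show {t : ℝ | (t, Y) ∈ obliqueTriangle σ s x y} = ∅ from ?_, measure_empty]
    exact eq_empty_of_forall_notMem fun t ht => h ht.2.1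

open MeasureTheory Set in
theorem le_volume_slice_openObliqueTriangle (σ : ℤˣ) (s x y Y : ℝ)
    (h : 0 < ((σ : ℤ) : ℝ) * (Y - y)) :
    ENNReal.ofReal (s - ((σ : ℤ) : ℝ) * (Y - y)) ≤
      volume {t : ℝ | (t, Y) ∈ openObliqueTriangle σ s x y} := by
  rcases Int.units_eq_one_or σ with rfl | rfl
  · refine le_trans ?_ (measure_mono (s := Ioo x (x + (s - (Y - y)))) ?_)
    · rw [Real.volume_Ioo]
      simp
    · rintro t ⟨h1, h3⟩
      refine ⟨?_, h, ?_⟩ <;> simp only [Units.val_one, Int.cast_one, one_mul] <;> linarith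
  · refine le_trans ?_ (measure_mono (s := Ioo (x - (s + (Y - y))) x) ?_)
    · rw [Real.volume_Ioo]
      exact ENNReal.ofReal_le_ofReal (by push_cast; linarith)
    · rintro t ⟨h1, h3⟩
      refine ⟨?_, h, ?_⟩ <;>
        simp only [Units.val_neg, Units.val_one, Int.cast_neg, Int.cast_one] <;> linarith

open MeasureTheory in
/-- Total length measure on the horizontal lines at heights `y + s (τ + k)`, `k : ℤ`. -/
noncomputable def gridLineMeasure (s y τ : ℝ) : Measure (ℝ × ℝ) :=
  Measure.sum fun k : ℤ => Measure.map (fun t : ℝ => (t, y + s * (τ + k))) volume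

open MeasureTheory in
theorem gridLineMeasure_apply (s y τ : ℝ) {A : Set (ℝ × ℝ)} (hA : MeasurableSet A) :
    gridLineMeasure s y τ A = ∑' k : ℤ, volume {t : ℝ | (t, y + s * (τ + k)) ∈ A} := by
  rw [gridLineMeasure, Measure.sum_apply _ hA]
  refine tsum_congr fun k => ?_
  rw [Measure.map_apply (by fun_prop) hA]
  rfl

theorem units_mul_self_real (σ : ℤˣ) : ((σ : ℤ) : ℝ) * ((σ : ℤ) : ℝ) = 1 := by
  exact_mod_cast Int.units_coe_mul_self σ

/-- Only the first line beyond the base can count: earlier lines miss the triangle and later ones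
are at distance more than `s > u` from the base. The width shrinks away from the base, so the
sawtooth has orientation `-σ`. The hypothesis on `τ` keeps the lines off the base. -/
theorem gridLineMeasure_obliqueTriangle_le {s u : ℝ} (hs : 0 < s) (hus : u < s) (σ : ℤˣ)
    (x y₀ c τ : ℝ) (hτ : Int.fract (((σ : ℤ) : ℝ) * (τ - c)) ≠ 0) :
    gridLineMeasure s y₀ τ (obliqueTriangle σ u x (y₀ + s * c)) ≤
      ENNReal.ofReal (s * max 0 (Int.fract (((-σ : ℤˣ) : ℤ) * (τ - c)) - (1 - u / s))) := by
  rw [gridLineMeasure_apply _ _ _ (measurableSet_obliqueTriangle _ _ _ _)]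
  set z : ℝ := ((σ : ℤ) : ℝ) * (τ - c) with hz
  have hheight : ∀ k : ℤ, ((σ : ℤ) : ℝ) * (y₀ + s * (τ + k) - (y₀ + s * c)) =
      s * (Int.fract z + ((⌊z⌋ + σ * k : ℤ) : ℝ)) := by
    intro k
    push_cast
    linear_combination s * hz.symm - s * Int.floor_add_fract z
  have hk₀ : ∀ k : ℤ, ⌊z⌋ + σ * k = 0 ↔ k = -(σ * ⌊z⌋) := by
    intro k
    rcases Int.units_eq_one_or σ with h | h <;> simp only [h, Units.val_neg, Units.val_one] <;>
      constructor <;> intro <;> linarith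
  have hf0 := Int.fract_nonneg z
  have hf1 := Int.fract_lt_one z
  rw [tsum_eq_single (-(σ * ⌊z⌋))]
  · refine (volume_slice_obliqueTriangle_le _ _ _ _ _).trans ?_
    rw [hheight, (hk₀ _).2 rfl, Int.cast_zero, add_zero, if_pos (by positivity)]
    apply ENNReal.ofReal_le_ofReal
    have : Int.fract (((-σ : ℤˣ) : ℤ) * (τ - c)) = 1 - Int.fract z := by
      rw [← Int.fract_neg hτ, hz]
      congr 1
      push_cast
      ring
    rw [this]
    calc u - s * Int.fract z = s * (1 - Int.fract z - (1 - u / s)) := by field_simp; ring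
      _ ≤ _ := mul_le_mul_of_nonneg_left (le_max_right _ _) hs.le
  · intro k hk
    refine le_antisymm ((volume_slice_obliqueTriangle_le _ _ _ _ _).trans ?_) zero_le
    rw [hheight]
    rcases lt_or_gt_of_ne (mt (hk₀ k).1 hk) with h | h
    · have h' : ((⌊z⌋ + σ * k : ℤ) : ℝ) ≤ -1 := by exact_mod_cast Int.le_sub_one_of_lt h
      rw [if_neg]
      rw [not_le]
      exact mul_neg_of_pos_of_neg hs (by linarith)
    · have h' : (1 : ℝ) ≤ ((⌊z⌋ + σ * k : ℤ) : ℝ) := by exact_mod_cast h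
      split_ifs
      · rw [ENNReal.ofReal_of_nonpos]
        have : s * 1 ≤ s * (Int.fract z + ((⌊z⌋ + σ * k : ℤ) : ℝ)) :=
          mul_le_mul_of_nonneg_left (by linarith) hs.le
        linarith
      · exact le_rfl

/-- Stated for open triangles because these are the disjoint ones, whose lengths add up. -/
theorem le_gridLineMeasure_openObliqueTriangle {s : ℝ} (hs : 0 < s) (σ : ℤˣ)
    (x y₀ : ℝ) (k : ℤ) (τ : ℝ) :
    ENNReal.ofReal (s * Int.fract (((-σ : ℤˣ) : ℤ) * τ)) ≤
      gridLineMeasure s y₀ τ (openObliqueTriangle σ s x (y₀ + s * k)) := by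
  rw [gridLineMeasure_apply _ _ _ (isOpen_openObliqueTriangle _ _ _ _).measurableSet]
  set z : ℝ := ((σ : ℤ) : ℝ) * τ with hz
  have hneg : (((-σ : ℤˣ) : ℤ) : ℝ) * τ = -z := by push_cast; ring
  rw [hneg]
  by_cases h0 : Int.fract z = 0
  · simp [Int.fract_neg_eq_zero.2 h0]
  have hpos : 0 < Int.fract z := lt_of_le_of_ne (Int.fract_nonneg z) (Ne.symm h0)
  have hheight : ((σ : ℤ) : ℝ) * (y₀ + s * (τ + ((k - σ * ⌊z⌋ : ℤ) : ℝ)) - (y₀ + s * k)) =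
      s * Int.fract z := by
    push_cast
    linear_combination s * hz.symm - s * Int.floor_add_fract z - s * ⌊z⌋ * units_mul_self_real σ
  refine le_trans ?_ (ENNReal.le_tsum (k - σ * ⌊z⌋))
  refine le_trans (ENNReal.ofReal_le_ofReal (le_of_eq ?_))
    (le_volume_slice_openObliqueTriangle _ _ _ _ _ (by rw [hheight]; positivity))
  rw [hheight, Int.fract_neg h0]
  ring

open MeasureTheory in
/-- Slicing by horizontal lines: triangles of side `s > 1`, of both orientations and with bases
on a common grid of lines, cannot be covered by unit triangles exceeding their number by one. -/
theorem not_iUnion_obliqueTriangle_subset {ι κ : Type*} [Fintype ι] [Fintype κ]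
    (hcard : Fintype.card ι = Fintype.card κ + 1) {s : ℝ} (hs : 1 < s)
    (ρ : κ → ℤˣ) (x : κ → ℝ) (y₀ : ℝ) (l : κ → ℤ)
    (hdisj : Pairwise (Function.onFun Disjoint
      fun j => openObliqueTriangle (ρ j) s (x j) (y₀ + s * l j)))
    {p q : κ} (hp : ρ p = 1) (hq : ρ q = -1) (σ : ι → ℤˣ) (a b : ι → ℝ) :
    ¬ (⋃ j, obliqueTriangle (ρ j) s (x j) (y₀ + s * l j)) ⊆
      ⋃ i, obliqueTriangle (σ i) 1 (a i) (b i) := by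
  intro hcov
  have hs0 : 0 < s := by linarith
  have hη : 0 < 1 - 1 / s := by
    rw [sub_pos, div_lt_one hs0]
    exact hs
  -- Widths are sawtooths of the opposite orientation, hence the signs and the exchange of `p` and
  -- `q`.
  refine not_sum_fract_le_sum_truncated hcard (fun i => -σ i) (fun j => -ρ j)
    (fun i => (b i - y₀) / s) hη (p := q) (q := p) (by simp [hq]) (by simp [hp]) ?_
  -- Only countably many phases put a line on the base of a covering triangle.
  have hgen : ∀ i, ∀ᵐ τ : ℝ, Int.fract (((σ i : ℤ) : ℝ) * (τ - (b i - y₀) / s)) ≠ 0 := by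
    intro i
    have hc : (Set.range fun k : ℤ => (b i - y₀) / s + k).Countable := Set.countable_range _
    filter_upwards [hc.ae_notMem volume] with τ hτ h
    apply hτ
    obtain ⟨k, hk⟩ := Int.fract_eq_zero_iff.1 h
    refine ⟨σ i * k, ?_⟩
    push_cast
    rw [hk]
    linear_combination (τ - (b i - y₀) / s) * units_mul_self_real (σ i)
  filter_upwards [ae_all_iff.2 hgen] with τ hτ
  have hlow : ENNReal.ofReal (∑ j, s * Int.fract (((-ρ j : ℤˣ) : ℤ) * τ)) ≤
      gridLineMeasure s y₀ τ (⋃ j, obliqueTriangle (ρ j) s (x j) (y₀ + s * l j)) := by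
    calc _ = ∑ j, ENNReal.ofReal (s * Int.fract (((-ρ j : ℤˣ) : ℤ) * τ)) :=
          ENNReal.ofReal_sum_of_nonneg fun j _ => mul_nonneg hs0.le (Int.fract_nonneg _)
      _ ≤ ∑ j, gridLineMeasure s y₀ τ (openObliqueTriangle (ρ j) s (x j) (y₀ + s * l j)) :=
          Finset.sum_le_sum fun j _ => le_gridLineMeasure_openObliqueTriangle hs0 _ _ _ _ _
      _ = gridLineMeasure s y₀ τ (⋃ j, openObliqueTriangle (ρ j) s (x j) (y₀ + s * l j)) := by
          rw [measure_iUnion hdisj fun j => (isOpen_openObliqueTriangle _ _ _ _).measurableSet,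
            tsum_fintype]
      _ ≤ _ := measure_mono (Set.iUnion_mono fun j => openObliqueTriangle_subset _ _ _ _)
  have hup : gridLineMeasure s y₀ τ (⋃ i, obliqueTriangle (σ i) 1 (a i) (b i)) ≤
      ENNReal.ofReal (∑ i, s *
        max 0 (Int.fract (((-σ i : ℤˣ) : ℤ) * (τ - (b i - y₀) / s)) - (1 - 1 / s))) := by
    rw [ENNReal.ofReal_sum_of_nonneg fun i _ => mul_nonneg hs0.le (le_max_left _ _)]
    refine (measure_iUnion_fintype_le _ _).trans (Finset.sum_le_sum fun i _ => ?_)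
    have hb : b i = y₀ + s * ((b i - y₀) / s) := by field_simp; ring
    conv_lhs => rw [hb]
    exact gridLineMeasure_obliqueTriangle_le hs0 hs _ _ _ _ _ (hτ i)
  have hfin := (hlow.trans (measure_mono hcov)).trans hup
  rw [ENNReal.ofReal_le_ofReal_iff (Finset.sum_nonneg fun i _ =>
    mul_nonneg hs0.le (le_max_left _ _)), ← Finset.mul_sum, ← Finset.mul_sum] at hfin
  exact le_of_mul_le_mul_left hfin hs0

/-! ### Trigons in oblique coordinates: the lower bound -/

/-- Two triangles of opposite orientation having a whole side in common. -/
def SideAdjacent {κ : Type*} (s : ℝ) (ρ : κ → ℤˣ) (x y : κ → ℝ) (i j : κ) : Prop :=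
  ρ j = -ρ i ∧
    ((x j = x i + ((ρ i : ℤ) : ℝ) * s ∧ y j = y i) ∨
     (x j = x i ∧ y j = y i + ((ρ i : ℤ) : ℝ) * s) ∨
     (x j = x i + ((ρ i : ℤ) : ℝ) * s ∧ y j = y i + ((ρ i : ℤ) : ℝ) * s))

/-- A family of triangles of side `s` with disjoint interiors, connected through common sides,
in oblique coordinates. -/
structure IsObliqueTrigon {κ : Type*} (s : ℝ) (ρ : κ → ℤˣ) (x y : κ → ℝ) : Prop where
  disjoint : Pairwise (Function.onFun Disjoint
    fun j => openObliqueTriangle (ρ j) s (x j) (y j))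
  connected : ∃ r, ∀ j, Relation.ReflTransGen (SideAdjacent s ρ x y) r j

theorem exists_grid_height {κ : Type*} {s : ℝ} {ρ : κ → ℤˣ} {x y : κ → ℝ} {r j : κ}
    (h : Relation.ReflTransGen (SideAdjacent s ρ x y) r j) : ∃ k : ℤ, y j = y r + s * k := by
  induction h with
  | refl => exact ⟨0, by simp⟩
  | @tail b c _ hbc ih =>
    obtain ⟨k, hk⟩ := ih
    rcases hbc.2 with ⟨-, h⟩ | ⟨-, h⟩ | ⟨-, h⟩
    · exact ⟨k, h.trans hk⟩
    all_goals
      refine ⟨k + ρ b, ?_⟩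
      rw [h, hk]
      push_cast
      ring

/-- A unit triangle cannot contain two vertices of a triangle of side `s > 1`. This settles the
single triangle, where the slicing argument lacks a second orientation. -/
theorem not_obliqueTriangle_subset_two {ι : Type*} [Fintype ι] (hcard : Fintype.card ι < 3)
    {s : ℝ} (hs : 1 < s) (ρ : ℤˣ) (x y : ℝ) (σ : ι → ℤˣ) (a b : ι → ℝ) :
    ¬ obliqueTriangle ρ s x y ⊆ ⋃ i, obliqueTriangle (σ i) 1 (a i) (b i) := by
  intro hcov
  let v : Fin 3 → ℝ × ℝ :=
    ![(x, y), (x + ((ρ : ℤ) : ℝ) * s, y), (x, y + ((ρ : ℤ) : ℝ) * s)]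
  have hv : ∀ k, v k ∈ obliqueTriangle ρ s x y := by
    intro k
    have := units_mul_self_real ρ
    fin_cases k <;> simp [v, obliqueTriangle, ← mul_assoc, this] <;> linarith
  choose f hf using fun k => Set.mem_iUnion.1 (hcov (hv k))
  obtain ⟨k, l, hkl, hfkl⟩ := Fintype.exists_ne_map_eq_of_card_lt f (by simpa using hcard)
  have h1 := hf k
  have h2 := hf l
  rw [← hfkl] at h2
  generalize σ (f k) = τ at h1 h2
  generalize a (f k) = a' at h1 h2
  generalize b (f k) = b' at h1 h2
  obtain ⟨h11, h12, h13⟩ := h1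
  obtain ⟨h21, h22, h23⟩ := h2
  rcases Int.units_eq_one_or τ with rfl | rfl <;> rcases Int.units_eq_one_or ρ with rfl | rfl <;>
    fin_cases k <;> fin_cases l <;> simp [v] at hkl h11 h12 h13 h21 h22 h23 <;> linarith

theorem IsObliqueTrigon.card_add_two_le {κ : Type*} [Fintype κ] {s : ℝ} (hs : 1 < s)
    {ρ : κ → ℤˣ} {x y : κ → ℝ} (h : IsObliqueTrigon s ρ x y) {k : ℕ} (σ : Fin k → ℤˣ)
    (a b : Fin k → ℝ) (hcov : (⋃ j, obliqueTriangle (ρ j) s (x j) (y j)) ⊆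
      ⋃ i, obliqueTriangle (σ i) 1 (a i) (b i)) :
    Fintype.card κ + 2 ≤ k := by
  by_contra! hk
  obtain ⟨r, hr⟩ := h.connected
  -- The parity argument needs exactly one covering triangle more than the trigon has, so a smaller
  -- cover is filled up with arbitrary unit triangles.
  let pad {α : Type} (d : α) (f : Fin k → α) (i : Fin (Fintype.card κ + 1)) : α :=
    if hi : (i : ℕ) < k then f ⟨i, hi⟩ else d
  have hcov' : (⋃ j, obliqueTriangle (ρ j) s (x j) (y j)) ⊆
      ⋃ i, obliqueTriangle (pad 1 σ i) 1 (pad 0 a i) (pad 0 b i) := by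
    refine hcov.trans (Set.iUnion_subset fun i => ?_)
    refine Set.subset_iUnion_of_subset ⟨i, by omega⟩ ?_
    have hpad : ∀ {α : Type} (d : α) (f : Fin k → α), pad d f ⟨i, by omega⟩ = f i :=
      fun d f => dif_pos i.2
    rw [hpad, hpad, hpad]
  by_cases hne : ∃ j, j ≠ r
  · obtain ⟨j, hj⟩ := hne
    -- The first step of a chain leaving `r` reverses the orientation.
    obtain ⟨c, hc⟩ : ∃ c, ρ c = -ρ r := by
      rcases (hr j).cases_head with h | ⟨c, hc, -⟩
      · exact absurd h.symm hj
      · exact ⟨c, hc.1⟩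
    obtain ⟨y₀, l, hl⟩ : ∃ (y₀ : ℝ) (l : κ → ℤ), ∀ j, y j = y₀ + s * l j := by
      choose l hl using fun j => exists_grid_height (hr j)
      exact ⟨y r, l, hl⟩
    have hdisj := h.disjoint
    simp only [hl] at hcov' hdisj
    have hcard : Fintype.card (Fin (Fintype.card κ + 1)) = Fintype.card κ + 1 := by simp
    rcases Int.units_eq_one_or (ρ r) with h1 | h1 <;> rw [h1] at hc
    · exact not_iUnion_obliqueTriangle_subset hcard hs ρ x _ l hdisj h1 hc _ _ _ hcov'
    · exact not_iUnion_obliqueTriangle_subset hcard hs ρ x _ l hdisj (by simpa using hc) h1 _ _ _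
        hcov'
  · push Not at hne
    have hcard : Fintype.card κ = 1 := Fintype.card_eq_one_iff.2 ⟨r, hne⟩
    refine not_obliqueTriangle_subset_two (by simp [hcard]) hs (ρ r) (x r) (y r) _ _ _
      ((Set.subset_iUnion (fun j => obliqueTriangle (ρ j) s (x j) (y j)) r).trans hcov')

/-! ### The upper bound: growing a cover along the trigon -/

/-- A set covered by `k` unit triangles in oblique coordinates. -/
def ObliqueCoverable (k : ℕ) (A : Set (ℝ × ℝ)) : Prop :=
  ∃ (σ : Fin k → ℤˣ) (a b : Fin k → ℝ), A ⊆ ⋃ i, obliqueTriangle (σ i) 1 (a i) (b i)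

theorem ObliqueCoverable.mono {k : ℕ} {A B : Set (ℝ × ℝ)} (h : ObliqueCoverable k B)
    (hAB : A ⊆ B) : ObliqueCoverable k A := by
  obtain ⟨σ, a, b, h⟩ := h
  exact ⟨σ, a, b, hAB.trans h⟩

theorem ObliqueCoverable.union_obliqueTriangle {k : ℕ} {A : Set (ℝ × ℝ)}
    (h : ObliqueCoverable k A) (τ : ℤˣ) (c d : ℝ) :
    ObliqueCoverable (k + 1) (obliqueTriangle τ 1 c d ∪ A) := by
  obtain ⟨σ, a, b, h⟩ := h
  refine ⟨Fin.cons τ σ, Fin.cons c a, Fin.cons d b, Set.union_subset ?_ (h.trans ?_)⟩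
  · exact Set.subset_iUnion_of_subset 0 subset_rfl
  · exact Set.iUnion_subset fun i => Set.subset_iUnion_of_subset i.succ subset_rfl

/-- One unit triangle sits in each corner. A point missed by two of them has both coordinates,
measured from the third corner, below `s - 1`, so their sum is below `2 * (s - 1) ≤ 1`. -/
theorem obliqueCoverable_three {s : ℝ} (hs : s ≤ 3 / 2) (σ : ℤˣ) (x y : ℝ) :
    ObliqueCoverable 3 (obliqueTriangle σ s x y) := by
  have h0 : ObliqueCoverable 0 ∅ := ⟨Fin.elim0, Fin.elim0, Fin.elim0, Set.empty_subset _⟩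
  refine (((h0.union_obliqueTriangle σ x y).union_obliqueTriangle σ
    (x + ((σ : ℤ) : ℝ) * (s - 1)) y).union_obliqueTriangle σ
    x (y + ((σ : ℤ) : ℝ) * (s - 1))).mono ?_
  rintro ⟨u, v⟩ ⟨h1, h2, h3⟩
  simp only [Set.mem_union, obliqueTriangle, Set.mem_ofPred_eq, Set.mem_empty_iff_false, or_false]
    at h1 h2 h3 ⊢
  have hσ := units_mul_self_real σ
  have e1 : ((σ : ℤ) : ℝ) * (u - (x + ((σ : ℤ) : ℝ) * (s - 1))) =
      ((σ : ℤ) : ℝ) * (u - x) - (s - 1) := by linear_combination -(s - 1) * hσ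
  have e2 : ((σ : ℤ) : ℝ) * (v - (y + ((σ : ℤ) : ℝ) * (s - 1))) =
      ((σ : ℤ) : ℝ) * (v - y) - (s - 1) := by linear_combination -(s - 1) * hσ
  rw [e1, e2]
  by_cases hv : s - 1 ≤ ((σ : ℤ) : ℝ) * (v - y)
  · left
    refine ⟨h1, ?_, ?_⟩ <;> linarith
  right
  by_cases hu : s - 1 ≤ ((σ : ℤ) : ℝ) * (u - x)
  · left
    refine ⟨?_, h2, ?_⟩ <;> linarith
  right
  exact ⟨h1, h2, by linarith⟩

/-- The triangle obtained from `obliqueTriangle σ s x y` by moving all sides outwards by `δ`. -/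
def enlargedTriangle (δ : ℝ) (σ : ℤˣ) (s x y : ℝ) : Set (ℝ × ℝ) :=
  obliqueTriangle σ (s + 3 * δ) (x - ((σ : ℤ) : ℝ) * δ) (y - ((σ : ℤ) : ℝ) * δ)

theorem mem_enlargedTriangle {δ : ℝ} {σ : ℤˣ} {s x y : ℝ} {q : ℝ × ℝ} :
    q ∈ enlargedTriangle δ σ s x y ↔ -δ ≤ ((σ : ℤ) : ℝ) * (q.1 - x) ∧
      -δ ≤ ((σ : ℤ) : ℝ) * (q.2 - y) ∧
      ((σ : ℤ) : ℝ) * (q.1 - x) + ((σ : ℤ) : ℝ) * (q.2 - y) ≤ s + δ := by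
  have hσ := units_mul_self_real σ
  have e : ∀ u v : ℝ, ((σ : ℤ) : ℝ) * (u - (v - ((σ : ℤ) : ℝ) * δ)) =
      ((σ : ℤ) : ℝ) * (u - v) + δ := fun u v => by linear_combination δ * hσ
  simp only [enlargedTriangle, obliqueTriangle, Set.mem_ofPred_eq, e]
  constructor <;> rintro ⟨h1, h2, h3⟩ <;> refine ⟨?_, ?_, ?_⟩ <;> linarith

theorem enlargedTriangle_zero (σ : ℤˣ) (s x y : ℝ) :
    enlargedTriangle 0 σ s x y = obliqueTriangle σ s x y := by
  simp [enlargedTriangle]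

theorem enlargedTriangle_mono {δ δ' : ℝ} (h : δ ≤ δ') (σ : ℤˣ) (s x y : ℝ) :
    enlargedTriangle δ σ s x y ⊆ enlargedTriangle δ' σ s x y := by
  intro q hq
  rw [mem_enlargedTriangle] at hq ⊢
  obtain ⟨h1, h2, h3⟩ := hq
  refine ⟨?_, ?_, ?_⟩ <;> linarith

/-- The unit triangle fills the corner of the enlarged triangle `j` opposite the common side. What
remains reaches at most `s - 1 + 2 * δ'` beyond that side and `2 * δ'` beyond the other two sides of
triangle `i`. The three cases are the three possible common sides. -/
theorem SideAdjacent.exists_enlargedTriangle_subset {κ : Type*} {s : ℝ} {ρ : κ → ℤˣ}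
    {x y : κ → ℝ} {i j : κ} (h : SideAdjacent s ρ x y i j) {δ δ' : ℝ} (_hδ : 0 ≤ δ')
    (hs : 1 ≤ s) (hδ : s - 1 + 2 * δ' ≤ δ) :
    ∃ a b, enlargedTriangle δ' (ρ j) s (x j) (y j) ⊆
      obliqueTriangle (ρ j) 1 a b ∪ enlargedTriangle δ (ρ i) s (x i) (y i) := by
  obtain ⟨hρ, h⟩ := h
  rw [hρ]
  generalize ρ i = σ at *
  rcases h with ⟨hx, hy⟩ | ⟨hx, hy⟩ | ⟨hx, hy⟩ <;> rw [hx, hy]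
  · refine ⟨x i + ((σ : ℤ) : ℝ) * (s + δ'), y i - ((σ : ℤ) : ℝ) * (s - 1 + 2 * δ'), ?_⟩
    intro q hq
    rw [Set.mem_union, or_iff_not_imp_left]
    rw [mem_enlargedTriangle] at hq ⊢
    simp only [obliqueTriangle, Set.mem_ofPred_eq, not_and_or, not_le]
    rintro hq'
    rcases Int.units_eq_one_or σ with rfl | rfl <;> push_cast at * <;> obtain ⟨h1, h2, h3⟩ := hq <;>
      rcases hq' with h | h | h <;> refine ⟨?_, ?_, ?_⟩ <;> linarith
  · refine ⟨x i - ((σ : ℤ) : ℝ) * (s - 1 + 2 * δ'), y i + ((σ : ℤ) : ℝ) * (s + δ'), ?_⟩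
    intro q hq
    rw [Set.mem_union, or_iff_not_imp_left]
    rw [mem_enlargedTriangle] at hq ⊢
    simp only [obliqueTriangle, Set.mem_ofPred_eq, not_and_or, not_le]
    rintro hq'
    rcases Int.units_eq_one_or σ with rfl | rfl <;> push_cast at * <;> obtain ⟨h1, h2, h3⟩ := hq <;>
      rcases hq' with h | h | h <;> refine ⟨?_, ?_, ?_⟩ <;> linarith
  · refine ⟨x i + ((σ : ℤ) : ℝ) * (s + δ'), y i + ((σ : ℤ) : ℝ) * (s + δ'), ?_⟩
    intro q hq
    rw [Set.mem_union, or_iff_not_imp_left]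
    rw [mem_enlargedTriangle] at hq ⊢
    simp only [obliqueTriangle, Set.mem_ofPred_eq, not_and_or, not_le]
    rintro hq'
    rcases Int.units_eq_one_or σ with rfl | rfl <;> push_cast at * <;> obtain ⟨h1, h2, h3⟩ := hq <;>
      rcases hq' with h | h | h <;> refine ⟨?_, ?_, ?_⟩ <;> linarith

theorem exists_rel_mem_notMem {κ : Type*} {R : κ → κ → Prop} {r : κ}
    (h : ∀ j, Relation.ReflTransGen R r j) {S : Set κ} (hr : r ∈ S) (hS : S ≠ Set.univ) :
    ∃ i ∈ S, ∃ j ∉ S, R i j := by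
  by_contra! hcon
  refine hS (Set.eq_univ_of_forall fun j => ?_)
  induction h j with
  | refl => exact hr
  | @tail b c _ hbc ih =>
    by_contra hc
    exact hcon b ih c hc hbc

theorem IsObliqueTrigon.obliqueCoverable {κ : Type*} [Fintype κ] {e : ℝ} (he : 0 ≤ e)
    (he' : e * (3 * 2 ^ Fintype.card κ) ≤ 1 / 2) {ρ : κ → ℤˣ} {x y : κ → ℝ}
    (h : IsObliqueTrigon (1 + e) ρ x y) :
    ObliqueCoverable (Fintype.card κ + 2)
      (⋃ j, obliqueTriangle (ρ j) (1 + e) (x j) (y j)) := by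
  classical
  obtain ⟨r, hr⟩ := h.connected
  set N := Fintype.card κ with hN
  have hN1 : 1 ≤ N := Fintype.card_pos_iff.2 ⟨r⟩
  -- The margins `δ k = e * (2 ^ (N - k) - 1)` solve `δ k = e + 2 * δ (k + 1)`, the loss when a
  -- triangle is attached, with `δ N = 0`. The first enlarged triangle has side `1 + e + 3 * δ 1 ≤ 3
  -- / 2` by `he'`.
  have key : ∀ k, 1 ≤ k → k ≤ N → ∃ S : Finset κ, S.card = k ∧ r ∈ S ∧
      ObliqueCoverable (k + 2)
        (⋃ j ∈ S, enlargedTriangle (e * (2 ^ (N - k) - 1)) (ρ j) (1 + e) (x j) (y j)) := by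
    intro k hk
    induction k, hk using Nat.le_induction with
    | base =>
      intro _
      refine ⟨{r}, by simp, by simp, ?_⟩
      simp only [Finset.mem_singleton, Set.iUnion_iUnion_eq_left]
      refine obliqueCoverable_three ?_ _ _ _
      have : (2 : ℝ) ^ (N - 1) ≤ 2 ^ N := pow_le_pow_right₀ (by norm_num) (by omega)
      nlinarith
    | succ k hk ih =>
      intro hkN
      obtain ⟨S, hcard, hrS, hcov⟩ := ih (by omega)
      have hne : (S : Set κ) ≠ Set.univ := by
        intro hS
        rw [Finset.coe_eq_univ] at hS
        rw [hS, Finset.card_univ] at hcard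
        omega
      obtain ⟨i, hi, j, hj, hij⟩ := exists_rel_mem_notMem hr (S := (S : Set κ)) hrS hne
      have hj' : j ∉ S := hj
      refine ⟨insert j S, by rw [Finset.card_insert_of_notMem hj', hcard],
        Finset.mem_insert_of_mem hrS, ?_⟩
      have hpow : (2 : ℝ) ^ (N - k) = 2 * 2 ^ (N - (k + 1)) := by
        rw [← pow_succ']
        congr 1
        omega
      have hone : (1 : ℝ) ≤ 2 ^ (N - (k + 1)) := one_le_pow₀ (by norm_num)
      have hδ' : 0 ≤ e * ((2 : ℝ) ^ (N - (k + 1)) - 1) := mul_nonneg he (by linarith)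
      obtain ⟨a, b, hab⟩ := hij.exists_enlargedTriangle_subset hδ' (by linarith)
        (δ := e * (2 ^ (N - k) - 1)) (by rw [hpow]; linarith)
      refine (hcov.union_obliqueTriangle (ρ j) a b).mono ?_
      rw [Finset.set_biUnion_insert]
      refine Set.union_subset (hab.trans ?_) ?_
      · exact Set.union_subset_union_right _ (Set.subset_biUnion_of_mem
          (u := fun j => enlargedTriangle _ (ρ j) (1 + e) (x j) (y j)) hi)
      · refine Set.subset_union_of_subset_right (Set.iUnion₂_mono fun l _ => ?_) _
        exact enlargedTriangle_mono (by rw [hpow]; nlinarith) _ _ _ _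
  obtain ⟨S, hcard, -, hcov⟩ := key N hN1 le_rfl
  rw [Finset.card_eq_iff_eq_univ] at hcard
  subst hcard
  simpa [enlargedTriangle_zero] using hcov

/-- The least number of unit triangles covering a set, in oblique coordinates. -/
theorem IsObliqueTrigon.isLeast {κ : Type*} [Fintype κ] {e : ℝ} (he : 0 < e)
    (he' : e * (3 * 2 ^ Fintype.card κ) ≤ 1 / 2) {ρ : κ → ℤˣ} {x y : κ → ℝ}
    (h : IsObliqueTrigon (1 + e) ρ x y) :
    IsLeast {k | ObliqueCoverable k (⋃ j, obliqueTriangle (ρ j) (1 + e) (x j) (y j))}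
      (Fintype.card κ + 2) := by
  refine ⟨h.obliqueCoverable he.le he', ?_⟩
  rintro k ⟨σ, a, b, hcov⟩
  exact h.card_add_two_le (by linarith) σ a b hcov

/-! ### Subdivision of a triangle into a trigon of `n ^ 2` cells -/

/-- Orientation of the cell `p` in the subdivision of a triangle of orientation `σ` into `n ^ 2`
cells. -/
def gridSign {n : ℕ} (σ : ℤˣ) (p : Fin n × Fin n) : ℤˣ :=
  if (p.1 : ℕ) + p.2 < n then σ else -σ

/-- Position, in one oblique coordinate, of the cell `p`: here `i` is the corresponding
component of `p`. -/
def gridCoord {n : ℕ} (σ : ℤˣ) (s x : ℝ) (p : Fin n × Fin n) (i : Fin n) : ℝ :=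
  x + ((σ : ℤ) : ℝ) * (s * if (p.1 : ℕ) + p.2 < n then (i : ℝ) else n - i)

theorem mem_grid_obliqueTriangle {n : ℕ} {σ : ℤˣ} {s x y : ℝ} {p : Fin n × Fin n} {q : ℝ × ℝ} :
    q ∈ obliqueTriangle (gridSign σ p) s (gridCoord σ s x p p.1) (gridCoord σ s y p p.2) ↔
      if (p.1 : ℕ) + p.2 < n then
        s * p.1 ≤ ((σ : ℤ) : ℝ) * (q.1 - x) ∧ s * p.2 ≤ ((σ : ℤ) : ℝ) * (q.2 - y) ∧
          ((σ : ℤ) : ℝ) * (q.1 - x) + ((σ : ℤ) : ℝ) * (q.2 - y) ≤ s * (p.1 + p.2 + 1)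
      else
        ((σ : ℤ) : ℝ) * (q.1 - x) ≤ s * (n - p.1) ∧ ((σ : ℤ) : ℝ) * (q.2 - y) ≤ s * (n - p.2) ∧
          s * ((n - p.1) + (n - p.2) - 1) ≤
            ((σ : ℤ) : ℝ) * (q.1 - x) + ((σ : ℤ) : ℝ) * (q.2 - y) := by
  simp only [obliqueTriangle, Set.mem_ofPred_eq, gridSign, gridCoord]
  split_ifs <;> rcases Int.units_eq_one_or σ with rfl | rfl <;> push_cast <;>
    constructor <;> rintro ⟨h1, h2, h3⟩ <;> refine ⟨?_, ?_, ?_⟩ <;> linarith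

theorem mem_grid_openObliqueTriangle {n : ℕ} {σ : ℤˣ} {s x y : ℝ} {p : Fin n × Fin n}
    {q : ℝ × ℝ} :
    q ∈ openObliqueTriangle (gridSign σ p) s (gridCoord σ s x p p.1) (gridCoord σ s y p p.2) ↔
      if (p.1 : ℕ) + p.2 < n then
        s * p.1 < ((σ : ℤ) : ℝ) * (q.1 - x) ∧ s * p.2 < ((σ : ℤ) : ℝ) * (q.2 - y) ∧
          ((σ : ℤ) : ℝ) * (q.1 - x) + ((σ : ℤ) : ℝ) * (q.2 - y) < s * (p.1 + p.2 + 1)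
      else
        ((σ : ℤ) : ℝ) * (q.1 - x) < s * (n - p.1) ∧ ((σ : ℤ) : ℝ) * (q.2 - y) < s * (n - p.2) ∧
          s * ((n - p.1) + (n - p.2) - 1) <
            ((σ : ℤ) : ℝ) * (q.1 - x) + ((σ : ℤ) : ℝ) * (q.2 - y) := by
  simp only [openObliqueTriangle, Set.mem_ofPred_eq, gridSign, gridCoord]
  split_ifs <;> rcases Int.units_eq_one_or σ with rfl | rfl <;> push_cast <;>
    constructor <;> rintro ⟨h1, h2, h3⟩ <;> refine ⟨?_, ?_, ?_⟩ <;> linarith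

theorem int_eq_of_mem_scaled_Ioo {s u : ℝ} (hs : 0 < s) {a c : ℤ} (h1 : s * a < u)
    (h2 : u < s * (a + 1)) (h3 : s * c < u) (h4 : u < s * (c + 1)) : a = c := by
  have h5 : (a : ℝ) < c + 1 := lt_of_mul_lt_mul_left (h1.trans h4) hs.le
  have h6 : (c : ℝ) < a + 1 := lt_of_mul_lt_mul_left (h3.trans h2) hs.le
  have h7 : a < c + 1 := by exact_mod_cast h5
  have h8 : c < a + 1 := by exact_mod_cast h6
  omega

/-- Each open cell lies in one open square of the lattice of mesh `s`, which is determined by any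
point of it; the two cells in a square are separated by its diagonal. -/
theorem pairwise_disjoint_grid {n : ℕ} {s : ℝ} (hs : 0 < s) (σ : ℤˣ) (x y : ℝ) :
    Pairwise (Function.onFun Disjoint fun p : Fin n × Fin n =>
      openObliqueTriangle (gridSign σ p) s (gridCoord σ s x p p.1) (gridCoord σ s y p p.2)) := by
  intro p p' hne
  refine Set.disjoint_left.2 fun q hq hq' => hne ?_
  rw [mem_grid_openObliqueTriangle] at hq hq'
  generalize ((σ : ℤ) : ℝ) * (q.1 - x) = u at hq hq'
  generalize ((σ : ℤ) : ℝ) * (q.2 - y) = v at hq hq'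
  split_ifs at hq hq' with h h' h' <;> obtain ⟨h1, h2, h3⟩ := hq <;> obtain ⟨g1, g2, g3⟩ := hq'
  · have e1 : ((p.1 : ℕ) : ℤ) = (p'.1 : ℕ) := by
      apply int_eq_of_mem_scaled_Ioo hs (u := u) <;> push_cast <;> linarith
    have e2 : ((p.2 : ℕ) : ℤ) = (p'.2 : ℕ) := by
      apply int_eq_of_mem_scaled_Ioo hs (u := v) <;> push_cast <;> linarith
    exact Prod.ext (Fin.ext (by exact_mod_cast e1)) (Fin.ext (by exact_mod_cast e2))
  · have e1 : ((p.1 : ℕ) : ℤ) = n - (p'.1 : ℕ) - 1 := by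
      apply int_eq_of_mem_scaled_Ioo hs (u := u) <;> push_cast <;> linarith
    have e2 : ((p.2 : ℕ) : ℤ) = n - (p'.2 : ℕ) - 1 := by
      apply int_eq_of_mem_scaled_Ioo hs (u := v) <;> push_cast <;> linarith
    have e1' : ((p.1 : ℕ) : ℝ) = n - (p'.1 : ℕ) - 1 := by exact_mod_cast e1
    have e2' : ((p.2 : ℕ) : ℝ) = n - (p'.2 : ℕ) - 1 := by exact_mod_cast e2
    rw [e1', e2'] at h3
    linarith
  · have e1 : ((p'.1 : ℕ) : ℤ) = n - (p.1 : ℕ) - 1 := by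
      apply int_eq_of_mem_scaled_Ioo hs (u := u) <;> push_cast <;> linarith
    have e2 : ((p'.2 : ℕ) : ℤ) = n - (p.2 : ℕ) - 1 := by
      apply int_eq_of_mem_scaled_Ioo hs (u := v) <;> push_cast <;> linarith
    have e1' : ((p'.1 : ℕ) : ℝ) = n - (p.1 : ℕ) - 1 := by exact_mod_cast e1
    have e2' : ((p'.2 : ℕ) : ℝ) = n - (p.2 : ℕ) - 1 := by exact_mod_cast e2
    rw [e1', e2'] at g3
    linarith
  · have e1 : (n - (p.1 : ℕ) - 1 : ℤ) = n - (p'.1 : ℕ) - 1 := by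
      apply int_eq_of_mem_scaled_Ioo hs (u := u) <;> push_cast <;> linarith
    have e2 : (n - (p.2 : ℕ) - 1 : ℤ) = n - (p'.2 : ℕ) - 1 := by
      apply int_eq_of_mem_scaled_Ioo hs (u := v) <;> push_cast <;> linarith
    exact Prod.ext (Fin.ext (by omega)) (Fin.ext (by omega))

/-- From a cell of orientation `σ`, crossing the diagonal side gives the reversed cell in the same
square, from which the next cell of orientation `σ` in either coordinate direction is adjacent. -/
theorem grid_connected {n : ℕ} (hn : 0 < n) (σ : ℤˣ) (s x y : ℝ) (p : Fin n × Fin n) :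
    Relation.ReflTransGen (SideAdjacent s (gridSign σ)
      (fun p => gridCoord σ s x p p.1) (fun p => gridCoord σ s y p p.2))
      (⟨0, hn⟩, ⟨0, hn⟩) p := by
  set R := SideAdjacent s (gridSign σ)
      (fun p : Fin n × Fin n => gridCoord σ s x p p.1) (fun p => gridCoord σ s y p p.2)
  have toDown : ∀ i j (h : i + j + 2 ≤ n),
      R (⟨i, by omega⟩, ⟨j, by omega⟩) (⟨n - 1 - i, by omega⟩, ⟨n - 1 - j, by omega⟩) := by
    intro i j h
    have h1 : i + j < n := by omega
    have h2 : ¬ (n - 1 - i) + (n - 1 - j) < n := by omega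
    have h3 : ((n - 1 - i : ℕ) : ℝ) = n - 1 - i := by
      rw [Nat.cast_sub (by omega), Nat.cast_sub (by omega), Nat.cast_one]
    have h4 : ((n - 1 - j : ℕ) : ℝ) = n - 1 - j := by
      rw [Nat.cast_sub (by omega), Nat.cast_sub (by omega), Nat.cast_one]
    simp only [R, SideAdjacent, gridSign, gridCoord, h1, h2, if_true, if_false, h3, h4]
    refine ⟨trivial, Or.inr (Or.inr ⟨?_, ?_⟩)⟩ <;> ring
  have toUp1 : ∀ i j (h : i + j + 2 ≤ n),
      R (⟨n - 1 - i, by omega⟩, ⟨n - 1 - j, by omega⟩) (⟨i + 1, by omega⟩, ⟨j, by omega⟩) := by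
    intro i j h
    have h1 : i + 1 + j < n := by omega
    have h2 : ¬ (n - 1 - i) + (n - 1 - j) < n := by omega
    have h3 : ((n - 1 - i : ℕ) : ℝ) = n - 1 - i := by
      rw [Nat.cast_sub (by omega), Nat.cast_sub (by omega), Nat.cast_one]
    have h4 : ((n - 1 - j : ℕ) : ℝ) = n - 1 - j := by
      rw [Nat.cast_sub (by omega), Nat.cast_sub (by omega), Nat.cast_one]
    simp only [R, SideAdjacent, gridSign, gridCoord, h1, h2, if_true, if_false, h3, h4, neg_neg]
    refine ⟨trivial, Or.inr (Or.inl ⟨?_, ?_⟩)⟩ <;> push_cast <;> ring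
  have toUp2 : ∀ i j (h : i + j + 2 ≤ n),
      R (⟨n - 1 - i, by omega⟩, ⟨n - 1 - j, by omega⟩) (⟨i, by omega⟩, ⟨j + 1, by omega⟩) := by
    intro i j h
    have h1 : i + (j + 1) < n := by omega
    have h2 : ¬ (n - 1 - i) + (n - 1 - j) < n := by omega
    have h3 : ((n - 1 - i : ℕ) : ℝ) = n - 1 - i := by
      rw [Nat.cast_sub (by omega), Nat.cast_sub (by omega), Nat.cast_one]
    have h4 : ((n - 1 - j : ℕ) : ℝ) = n - 1 - j := by
      rw [Nat.cast_sub (by omega), Nat.cast_sub (by omega), Nat.cast_one]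
    simp only [R, SideAdjacent, gridSign, gridCoord, h1, h2, if_true, if_false, h3, h4, neg_neg]
    refine ⟨trivial, Or.inl ⟨?_, ?_⟩⟩ <;> push_cast <;> ring
  have up : ∀ i j (h : i + j < n), Relation.ReflTransGen R (⟨0, hn⟩, ⟨0, hn⟩)
      (⟨i, by omega⟩, ⟨j, by omega⟩) := by
    intro i
    induction i with
    | zero =>
      intro j
      induction j with
      | zero => exact fun _ => Relation.ReflTransGen.refl
      | succ j ih =>
        exact fun h => ((ih (by omega)).tail (toDown 0 j (by omega))).tail (toUp2 0 j (by omega))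
    | succ i ih =>
      exact fun j h => ((ih j (by omega)).tail (toDown i j (by omega))).tail (toUp1 i j (by omega))
  obtain ⟨⟨i, hi⟩, ⟨j, hj⟩⟩ := p
  by_cases h : i + j < n
  · exact up i j h
  · have := (up (n - 1 - i) (n - 1 - j) (by omega)).tail (toDown _ _ (by omega))
    convert this using 3 <;> omega

theorem isObliqueTrigon_grid {n : ℕ} (hn : 0 < n) {s : ℝ} (hs : 0 < s) (σ : ℤˣ) (x y : ℝ) :
    IsObliqueTrigon s (gridSign σ)
      (fun p : Fin n × Fin n => gridCoord σ s x p p.1) (fun p => gridCoord σ s y p p.2) :=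
  ⟨pairwise_disjoint_grid hs σ x y, _, grid_connected hn σ s x y⟩

theorem iUnion_grid {n : ℕ} (hn : 0 < n) {s : ℝ} (hs : 0 < s) (σ : ℤˣ) (x y : ℝ) :
    ⋃ p : Fin n × Fin n, obliqueTriangle (gridSign σ p) s (gridCoord σ s x p p.1)
      (gridCoord σ s y p p.2) = obliqueTriangle σ (n * s) x y := by
  ext q
  rw [Set.mem_iUnion]
  simp only [mem_grid_obliqueTriangle]
  simp only [obliqueTriangle, Set.mem_ofPred_eq]
  generalize ((σ : ℤ) : ℝ) * (q.1 - x) = u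
  generalize ((σ : ℤ) : ℝ) * (q.2 - y) = v
  constructor
  · rintro ⟨⟨i, j⟩, h⟩
    have hi : (i : ℝ) + 1 ≤ n := by exact_mod_cast i.2
    have hj : (j : ℝ) + 1 ≤ n := by exact_mod_cast j.2
    split_ifs at h with hij <;> obtain ⟨h1, h2, h3⟩ := h <;> dsimp only at h1 h2 h3 hij
    · have hij' : (i : ℝ) + j + 1 ≤ n := by exact_mod_cast hij
      refine ⟨le_trans (by positivity) h1, le_trans (by positivity) h2, h3.trans ?_⟩
      rw [mul_comm]
      exact mul_le_mul_of_nonneg_right hij' hs.le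
    · have hij' : (n : ℝ) ≤ i + j := by exact_mod_cast not_lt.1 hij
      refine ⟨?_, ?_, ?_⟩ <;> nlinarith
  · rintro ⟨h1, h2, h3⟩
    obtain ⟨a, rfl⟩ : ∃ a, u = s * a := ⟨u / s, by field_simp⟩
    obtain ⟨b, rfl⟩ : ∃ b, v = s * b := ⟨v / s, by field_simp⟩
    have ha : 0 ≤ a := nonneg_of_mul_nonneg_right h1 hs
    have hb : 0 ≤ b := nonneg_of_mul_nonneg_right h2 hs
    have hab : a + b ≤ n := le_of_mul_le_mul_left (by linarith) hs
    have hmul : ∀ {c d : ℝ}, c ≤ d → s * c ≤ s * d := fun h => mul_le_mul_of_nonneg_left h hs.le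
    have fa := Nat.floor_le ha
    have fb := Nat.floor_le hb
    have fa' := Nat.lt_floor_add_one a
    have fb' := Nat.lt_floor_add_one b
    generalize ⌊a⌋₊ = i at *
    generalize ⌊b⌋₊ = j at *
    by_cases hij : i + j < n
    · by_cases hf : a + b ≤ i + j + 1
      · refine ⟨(⟨i, by omega⟩, ⟨j, by omega⟩), ?_⟩
        rw [if_pos hij, ← mul_add]
        exact ⟨hmul fa, hmul fb, hmul hf⟩
      · have : i + j + 1 < n := by
          have : ((i + j + 1 : ℕ) : ℝ) < n := by push_cast; linarith
          exact_mod_cast this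
        refine ⟨(⟨n - 1 - i, by omega⟩, ⟨n - 1 - j, by omega⟩), ?_⟩
        have e1 : ((n - 1 - i : ℕ) : ℝ) = n - 1 - i := by
          rw [Nat.cast_sub (by omega), Nat.cast_sub (by omega), Nat.cast_one]
        have e2 : ((n - 1 - j : ℕ) : ℝ) = n - 1 - j := by
          rw [Nat.cast_sub (by omega), Nat.cast_sub (by omega), Nat.cast_one]
        rw [if_neg (by dsimp only; omega), ← mul_add]
        simp only [e1, e2]
        exact ⟨hmul (by linarith), hmul (by linarith), hmul (by linarith)⟩
    -- Here the point is a lattice point on the diagonal side, so the floors overshoot; lowering one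
    -- positive index gives a cell with it as a vertex.
    · have hij' : (n : ℝ) ≤ i + j := by exact_mod_cast not_lt.1 hij
      have ea : a = i := by linarith
      have eb : b = j := by linarith
      have hn' : i + j = n := by
        have : ((i + j : ℕ) : ℝ) = n := by push_cast; linarith
        exact_mod_cast this
      rcases Nat.eq_zero_or_pos i with h0 | h0
      · refine ⟨(⟨i, by omega⟩, ⟨j - 1, by omega⟩), ?_⟩
        have e : ((j - 1 : ℕ) : ℝ) = j - 1 := by rw [Nat.cast_sub (by omega), Nat.cast_one]
        rw [if_pos (by dsimp only; omega), ← mul_add]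
        simp only [e]
        exact ⟨hmul (by linarith), hmul (by linarith), hmul (by linarith)⟩
      · refine ⟨(⟨i - 1, by omega⟩, ⟨j, by omega⟩), ?_⟩
        have e : ((i - 1 : ℕ) : ℝ) = i - 1 := by rw [Nat.cast_sub (by omega), Nat.cast_one]
        rw [if_pos (by dsimp only; omega), ← mul_add]
        simp only [e]
        exact ⟨hmul (by linarith), hmul (by linarith), hmul (by linarith)⟩

/-! ### Passage between the Euclidean plane and oblique coordinates -/

/-- Oblique coordinates on the plane, in which equilateral `H`-triangles are the
`obliqueTriangle`s. -/
noncomputable def obliqueCoord : Plane →ₗ[ℝ] ℝ × ℝ where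
  toFun p := (p 0 - p 1 / √3, 2 * p 1 / √3)
  map_add' p q := by ext <;> simp <;> ring
  map_smul' c p := by ext <;> simp <;> ring

theorem obliqueCoord_apply (p : Plane) : obliqueCoord p = (p 0 - p 1 / √3, 2 * p 1 / √3) := rfl

/-- The point with given oblique coordinates. -/
noncomputable def obliquePoint (q : ℝ × ℝ) : Plane := !₂[q.1 + q.2 / 2, q.2 * √3 / 2]

theorem obliqueCoord_obliquePoint (q : ℝ × ℝ) : obliqueCoord (obliquePoint q) = q := by
  have h3 : √3 ≠ 0 := by positivity
  ext
  · simp [obliqueCoord_apply, obliquePoint]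
    field_simp
    ring
  · simp [obliqueCoord_apply, obliquePoint]
    field_simp

theorem obliquePoint_obliqueCoord (p : Plane) : obliquePoint (obliqueCoord p) = p := by
  have h3 : √3 ≠ 0 := by positivity
  ext i
  fin_cases i
  · simp [obliqueCoord_apply, obliquePoint]
    field_simp
    ring
  · simp [obliqueCoord_apply, obliquePoint]

theorem obliqueCoord_injective : Function.Injective obliqueCoord :=
  Function.LeftInverse.injective obliquePoint_obliqueCoord

theorem obliqueCoord_surjective : Function.Surjective obliqueCoord :=
  Function.RightInverse.surjective obliqueCoord_obliquePoint

theorem continuous_obliqueCoord : Continuous obliqueCoord :=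
  LinearMap.continuous_of_finiteDimensional _

/-- The vertices of `obliqueTriangle σ s x y`. -/
def obliqueVertices (σ : ℤˣ) (s x y : ℝ) : Set (ℝ × ℝ) :=
  {(x, y), (x + ((σ : ℤ) : ℝ) * s, y), (x, y + ((σ : ℤ) : ℝ) * s)}

theorem convex_obliqueTriangle (σ : ℤˣ) (s x y : ℝ) : Convex ℝ (obliqueTriangle σ s x y) := by
  rintro p ⟨p1, p2, p3⟩ q ⟨q1, q2, q3⟩ a b ha hb hab
  simp only [obliqueTriangle, Set.mem_ofPred_eq, Prod.fst_add, Prod.snd_add, Prod.smul_fst,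
    Prod.smul_snd, smul_eq_mul]
  have e : ∀ u v w : ℝ, ((σ : ℤ) : ℝ) * (a * u + b * v - w) =
      a * (((σ : ℤ) : ℝ) * (u - w)) + b * (((σ : ℤ) : ℝ) * (v - w)) := fun u v w => by
    linear_combination ((σ : ℤ) : ℝ) * w * hab
  rw [e, e]
  refine ⟨by positivity, by positivity, ?_⟩
  have := mul_le_mul_of_nonneg_left p3 ha
  have := mul_le_mul_of_nonneg_left q3 hb
  have : a * s + b * s = s := by rw [← add_mul, hab, one_mul]
  linarith

theorem convexHull_obliqueVertices {s : ℝ} (hs : 0 < s) (σ : ℤˣ) (x y : ℝ) :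
    convexHull ℝ (obliqueVertices σ s x y) = obliqueTriangle σ s x y := by
  have hσ := units_mul_self_real σ
  apply Set.Subset.antisymm
  · refine convexHull_min ?_ (convex_obliqueTriangle σ s x y)
    rintro q (rfl | rfl | rfl) <;> simp [obliqueTriangle, ← mul_assoc, hσ, hs.le]
  · rintro ⟨u, v⟩ ⟨h1, h2, h3⟩
    dsimp only at h1 h2 h3
    set a := ((σ : ℤ) : ℝ) * (u - x) with ha
    set b := ((σ : ℤ) : ℝ) * (v - y) with hb
    have hu : u = x + ((σ : ℤ) : ℝ) * a := by linear_combination -(u - x) * hσ - ((σ : ℤ) : ℝ) * ha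
    have hv : v = y + ((σ : ℤ) : ℝ) * b := by linear_combination -(v - y) * hσ - ((σ : ℤ) : ℝ) * hb
    have hmem := (convex_convexHull ℝ (obliqueVertices σ s x y)).sum_mem
      -- Barycentric coordinates of the point.
      (t := Finset.univ) (w := ![(s - a - b) / s, a / s, b / s])
      (z := ![(x, y), (x + ((σ : ℤ) : ℝ) * s, y), (x, y + ((σ : ℤ) : ℝ) * s)])
      (by
        intro i _
        fin_cases i
        · exact div_nonneg (by linarith) hs.le
        · exact div_nonneg h1 hs.le
        · exact div_nonneg h2 hs.le)
      (by
        simp only [Fin.sum_univ_three, Matrix.cons_val]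
        field_simp
        ring)
      (by
        intro i _
        apply subset_convexHull
        fin_cases i <;> simp [obliqueVertices])
    convert hmem using 1
    simp only [Fin.sum_univ_three, Matrix.cons_val]
    ext
    · simp only [Prod.fst_add, Prod.smul_fst, smul_eq_mul, hu]
      field_simp
      ring
    · simp only [Prod.snd_add, Prod.smul_snd, smul_eq_mul, hv]
      field_simp
      ring

theorem closedInterior_eq_preimage {T : Affine.Triangle ℝ Plane} {σ : ℤˣ} {s x y : ℝ} (hs : 0 < s)
    (h : obliqueCoord '' Set.range T.points = obliqueVertices σ s x y) :
    T.closedInterior = obliqueCoord ⁻¹' obliqueTriangle σ s x y := by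
  rw [← convexHull_obliqueVertices hs, ← h, ← LinearMap.image_convexHull,
    Set.preimage_image_eq _ obliqueCoord_injective, Affine.Simplex.convexHull_eq_closedInterior]

theorem dist_sq_plane (p q : Plane) : dist p q ^ 2 = (p 0 - q 0) ^ 2 + (p 1 - q 1) ^ 2 := by
  rw [EuclideanSpace.dist_eq, Real.sq_sqrt (by positivity)]
  simp [Fin.sum_univ_two, Real.dist_eq, sq_abs]

theorem exists_obliqueVertices_of_dist {A B C : Plane} {s : ℝ} (hs : 0 < s) (hAB : A 1 = B 1)
    (h1 : dist A B = s) (h2 : dist A C = s) (h3 : dist B C = s) :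
    ∃ (σ : ℤˣ) (x y : ℝ), obliqueCoord '' {A, B, C} = obliqueVertices σ s x y := by
  have hr : √3 ^ 2 = 3 := Real.sq_sqrt (by norm_num)
  have hr0 : √3 ≠ 0 := by positivity
  have d1 := dist_sq_plane A B
  have d2 := dist_sq_plane A C
  have d3 := dist_sq_plane B C
  rw [h1] at d1
  rw [h2] at d2
  rw [h3] at d3
  have main : ∀ (σ : ℤˣ) (P Q : Plane), P 1 = Q 1 → Q 0 - P 0 = ((σ : ℤ) : ℝ) * s →
      2 * C 0 = P 0 + Q 0 → C 1 - P 1 = ((σ : ℤ) : ℝ) * (√3 / 2 * s) →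
      obliqueCoord '' {P, Q, C} =
        obliqueVertices σ s (P 0 - P 1 / √3) (2 * P 1 / √3) := by
    intro σ P Q e1 e2 e3 e4
    have hQ : Q 0 = P 0 + ((σ : ℤ) : ℝ) * s := by linarith
    have hC1 : C 1 = P 1 + ((σ : ℤ) : ℝ) * (√3 / 2 * s) := by linarith
    have hC0 : C 0 = P 0 + ((σ : ℤ) : ℝ) * s / 2 := by linarith
    simp only [Set.image_insert_eq, Set.image_singleton, obliqueCoord_apply, obliqueVertices,
      ← e1, hQ, hC0, hC1]
    have f1 : P 0 + ((σ : ℤ) : ℝ) * s - P 1 / √3 = P 0 - P 1 / √3 + ((σ : ℤ) : ℝ) * s := by ring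
    have f2 : P 0 + ((σ : ℤ) : ℝ) * s / 2 - (P 1 + ((σ : ℤ) : ℝ) * (√3 / 2 * s)) / √3 =
        P 0 - P 1 / √3 := by
      field_simp
      ring
    have f3 : 2 * (P 1 + ((σ : ℤ) : ℝ) * (√3 / 2 * s)) / √3 =
        2 * P 1 / √3 + ((σ : ℤ) : ℝ) * s := by
      field_simp
    rw [f1, f2, f3]
  have hne : A 0 - B 0 ≠ 0 := by
    intro h
    rw [h, hAB] at d1
    nlinarith
  have hmid : 2 * C 0 = A 0 + B 0 := by
    have : (A 0 - B 0) * (A 0 + B 0 - 2 * C 0) = 0 := by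
      rw [hAB] at d2
      linear_combination d3 - d2
    rcases mul_eq_zero.1 this with h | h
    · exact absurd h hne
    · linarith
  have hapex : (C 1 - A 1) ^ 2 = (√3 / 2 * s) ^ 2 := by
    have e : A 0 - C 0 = (A 0 - B 0) / 2 := by linarith
    rw [e] at d2
    rw [hAB, sub_self] at d1
    rw [mul_pow, div_pow, hr]
    linear_combination -d2 + d1 / 4
  have hbase : (A 0 - B 0) ^ 2 = s ^ 2 := by
    rw [hAB, sub_self] at d1
    linear_combination -d1
  obtain ⟨σ, hσ⟩ : ∃ σ : ℤˣ, C 1 - A 1 = ((σ : ℤ) : ℝ) * (√3 / 2 * s) := by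
    rcases sq_eq_sq_iff_eq_or_eq_neg.1 hapex with h | h
    · exact ⟨1, by simpa using h⟩
    · exact ⟨-1, by simpa using h⟩
  obtain ⟨τ, hτ⟩ : ∃ τ : ℤˣ, B 0 - A 0 = ((τ : ℤ) : ℝ) * s := by
    rcases sq_eq_sq_iff_eq_or_eq_neg.1 hbase with h | h
    · exact ⟨-1, by push_cast; linarith⟩
    · exact ⟨1, by push_cast; linarith⟩
  -- `σ` says on which side of the base the apex lies. The base must be traversed in direction `σ`
  -- for its first endpoint to be the corner `(x, y)`, so its endpoints are exchanged when `τ = -σ`.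
  by_cases hστ : τ = σ
  · exact ⟨σ, _, _, main σ A B hAB (hστ ▸ hτ) hmid hσ⟩
  · have hτ' : τ = -σ := by
      rcases Int.units_eq_one_or σ with rfl | rfl <;>
        rcases Int.units_eq_one_or τ with rfl | rfl <;> simp_all
    refine ⟨σ, B 0 - B 1 / √3, 2 * B 1 / √3, ?_⟩
    rw [Set.insert_comm]
    refine main σ B A hAB.symm ?_ (by linarith) (by rw [← hAB]; exact hσ)
    rw [hτ'] at hτ
    push_cast at hτ
    linarith

theorem IsEquilateralHTriangle.exists_obliqueVertices {s : ℝ} {T : Affine.Triangle ℝ Plane}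
    (h : IsEquilateralHTriangle s T) :
    0 < s ∧ ∃ (σ : ℤˣ) (x y : ℝ),
      obliqueCoord '' Set.range T.points = obliqueVertices σ s x y := by
  obtain ⟨⟨i, j, hij, hy⟩, hd⟩ := h
  have hs : 0 < s := by
    rw [← hd i j hij, dist_pos]
    exact T.independent.injective.ne hij
  obtain ⟨k, hik, hjk, huniv⟩ : ∃ k : Fin 3, i ≠ k ∧ j ≠ k ∧
      (Set.univ : Set (Fin 3)) = {i, j, k} := by
    have : ∀ i j : Fin 3, i ≠ j → ∃ k : Fin 3, i ≠ k ∧ j ≠ k ∧ ∀ l, l = i ∨ l = j ∨ l = k := by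
      decide
    obtain ⟨k, h1, h2, h3⟩ := this i j hij
    exact ⟨k, h1, h2, (Set.eq_univ_of_forall h3).symm⟩
  refine ⟨hs, ?_⟩
  have hrange : Set.range T.points = {T.points i, T.points j, T.points k} := by
    rw [← Set.image_univ, huniv, Set.image_insert_eq, Set.image_insert_eq, Set.image_singleton]
  rw [hrange]
  exact exists_obliqueVertices_of_dist hs hy (hd i j hij) (hd i k hik) (hd j k hjk)

theorem affineIndependent_obliquePoint {s : ℝ} (hs : 0 < s) (σ : ℤˣ) (x y : ℝ) :
    AffineIndependent ℝ ![obliquePoint (x, y), obliquePoint (x + ((σ : ℤ) : ℝ) * s, y),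
      obliquePoint (x, y + ((σ : ℤ) : ℝ) * s)] := by
  rw [affineIndependent_iff_of_fintype]
  intro w hw h
  rw [Finset.weightedVSub_eq_linear_combination _ hw] at h
  have hσ : ((σ : ℤ) : ℝ) * s ≠ 0 := mul_ne_zero (by exact_mod_cast σ.ne_zero) hs.ne'
  have h' := congrArg obliqueCoord h
  simp only [Fin.sum_univ_three, Matrix.cons_val, map_add, map_smul, obliqueCoord_obliquePoint,
    map_zero] at h' hw
  have g1 := congrArg Prod.fst h'
  have g2 := congrArg Prod.snd h'
  simp only [Prod.fst_add, Prod.smul_fst, smul_eq_mul, Prod.fst_zero, Prod.snd_add, Prod.smul_snd,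
    Prod.snd_zero] at g1 g2
  have w1 : w 1 = 0 := by
    have : w 1 * (((σ : ℤ) : ℝ) * s) = 0 := by linear_combination g1 - x * hw
    exact (mul_eq_zero.1 this).resolve_right hσ
  have w2 : w 2 = 0 := by
    have : w 2 * (((σ : ℤ) : ℝ) * s) = 0 := by linear_combination g2 - y * hw
    exact (mul_eq_zero.1 this).resolve_right hσ
  have w0 : w 0 = 0 := by linarith
  intro i
  fin_cases i
  exacts [w0, w1, w2]

theorem exists_isEquilateralHTriangle {s : ℝ} (hs : 0 < s) (σ : ℤˣ) (x y : ℝ) :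
    ∃ T : Affine.Triangle ℝ Plane, IsEquilateralHTriangle s T ∧
      T.closedInterior = obliqueCoord ⁻¹' obliqueTriangle σ s x y := by
  have hr : √3 ^ 2 = 3 := Real.sq_sqrt (by norm_num)
  have hσ := units_mul_self_real σ
  set A := obliquePoint (x, y) with hA
  set B := obliquePoint (x + ((σ : ℤ) : ℝ) * s, y) with hB
  set C := obliquePoint (x, y + ((σ : ℤ) : ℝ) * s) with hC
  have of_sq : ∀ p q : Plane, (p 0 - q 0) ^ 2 + (p 1 - q 1) ^ 2 = s ^ 2 → dist p q = s := by
    intro p q h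
    rw [← dist_sq_plane] at h
    exact (sq_eq_sq₀ dist_nonneg hs.le).1 h
  have dAB : dist A B = s := by
    apply of_sq
    simp [A, B, obliquePoint]
    linear_combination s ^ 2 * hσ
  have dAC : dist A C = s := by
    apply of_sq
    simp [A, C, obliquePoint]
    linear_combination s ^ 2 * hσ + (((σ : ℤ) : ℝ) * s) ^ 2 / 4 * hr
  have dBC : dist B C = s := by
    apply of_sq
    simp [B, C, obliquePoint]
    linear_combination s ^ 2 * hσ + (((σ : ℤ) : ℝ) * s) ^ 2 / 4 * hr
  refine ⟨⟨![A, B, C], affineIndependent_obliquePoint hs σ x y⟩, ⟨⟨0, 1, by decide, ?_⟩, ?_⟩, ?_⟩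
  · simp [A, B, obliquePoint]
  · intro i j hij
    fin_cases i <;> fin_cases j <;> first | exact absurd rfl hij | skip
    exacts [dAB, dAC, by rw [dist_comm]; exact dAB, dBC, by rw [dist_comm]; exact dAC,
      by rw [dist_comm]; exact dBC]
  · apply closedInterior_eq_preimage hs
    have hrange : Set.range ![A, B, C] = {A, B, C} := by
      rw [Matrix.range_cons, Matrix.range_cons_cons_empty, Set.singleton_union]
    rw [hrange, Set.image_insert_eq, Set.image_insert_eq, Set.image_singleton]
    simp only [A, B, C, obliqueCoord_obliquePoint, obliqueVertices]

theorem coverableByUnit_preimage_iff {k : ℕ} {A : Set (ℝ × ℝ)} :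
    CoverableByUnit k (obliqueCoord ⁻¹' A) ↔ ObliqueCoverable k A := by
  constructor
  · rintro ⟨T, hT, hcov⟩
    choose hs σ a b h using fun i => (hT i).exists_obliqueVertices
    refine ⟨σ, a, b, ?_⟩
    simp only [fun i => closedInterior_eq_preimage (hs i) (h i), ← Set.preimage_iUnion] at hcov
    exact (Set.preimage_subset_preimage_iff (by simp [obliqueCoord_surjective.range_eq])).1 hcov
  · rintro ⟨σ, a, b, hcov⟩
    choose T hT hT' using fun i => exists_isEquilateralHTriangle one_pos (σ i) (a i) (b i)
    refine ⟨T, hT, ?_⟩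
    simp only [hT', ← Set.preimage_iUnion]
    exact Set.preimage_mono hcov

theorem IsObliqueTrigon.isUnitCoverNumber {κ : Type*} [Fintype κ] {e : ℝ} (he : 0 < e)
    (he' : e * (3 * 2 ^ Fintype.card κ) ≤ 1 / 2) {ρ : κ → ℤˣ} {x y : κ → ℝ}
    (h : IsObliqueTrigon (1 + e) ρ x y) :
    IsUnitCoverNumber (obliqueCoord ⁻¹' ⋃ j, obliqueTriangle (ρ j) (1 + e) (x j) (y j))
      (Fintype.card κ + 2) := by
  simpa only [IsUnitCoverNumber, coverableByUnit_preimage_iff] using h.isLeast he he'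

/-- Two translates with two common vertices coincide, which disjointness of the open triangles
excludes, so the orientations are opposite and the common side determines the position. -/
theorem sideAdjacent_of_common_vertices {κ : Type*} {s : ℝ} (hs : 0 < s) {ρ : κ → ℤˣ}
    {x y : κ → ℝ} {i j : κ}
    (hdisj : Disjoint (openObliqueTriangle (ρ i) s (x i) (y i))
      (openObliqueTriangle (ρ j) s (x j) (y j)))
    {p q : ℝ × ℝ} (hpq : p ≠ q) (hpi : p ∈ obliqueVertices (ρ i) s (x i) (y i))
    (hqi : q ∈ obliqueVertices (ρ i) s (x i) (y i)) (hpj : p ∈ obliqueVertices (ρ j) s (x j) (y j))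
    (hqj : q ∈ obliqueVertices (ρ j) s (x j) (y j)) : SideAdjacent s ρ x y i j := by
  have hsame : ¬ (ρ j = ρ i ∧ x j = x i ∧ y j = y i) := by
    rintro ⟨h1, h2, h3⟩
    rw [h1, h2, h3, disjoint_self] at hdisj
    have hσ := units_mul_self_real (ρ i)
    have : (x i + ((ρ i : ℤ) : ℝ) * (s / 3), y i + ((ρ i : ℤ) : ℝ) * (s / 3)) ∈
        openObliqueTriangle (ρ i) s (x i) (y i) := by
      simp only [openObliqueTriangle, Set.mem_ofPred_eq, add_sub_cancel_left, ← mul_assoc, hσ,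
        one_mul]
      refine ⟨?_, ?_, ?_⟩ <;> linarith
    rw [hdisj] at this
    exact this
  obtain ⟨u, v⟩ := p
  obtain ⟨u', v'⟩ := q
  simp only [obliqueVertices, Set.mem_insert_iff, Set.mem_singleton_iff, Prod.mk.injEq, ne_eq]
    at hpq hpi hqi hpj hqj
  unfold SideAdjacent
  generalize ρ i = σ at *
  generalize ρ j = τ at *
  generalize x i = a at *
  generalize y i = b at *
  generalize x j = c at *
  generalize y j = d at *
  rcases Int.units_eq_one_or σ with rfl | rfl <;> rcases Int.units_eq_one_or τ with rfl | rfl <;>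
    simp only [Units.val_one, Units.val_neg, Int.cast_one, Int.cast_neg, one_mul, neg_mul, neg_neg,
      true_and] at hsame hpi hqi hpj hqj ⊢
  all_goals
    rcases hpi with ⟨rfl, rfl⟩ | ⟨rfl, rfl⟩ | ⟨rfl, rfl⟩ <;>
    rcases hqi with ⟨rfl, rfl⟩ | ⟨rfl, rfl⟩ | ⟨rfl, rfl⟩ <;>
    first
    | exact absurd ⟨rfl, rfl⟩ hpq
    | grind

theorem IsTrigon.exists_isObliqueTrigon {n : ℕ} {s : ℝ} {X : Set Plane} (h : IsTrigon n s X) :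
    ∃ (ρ : Fin n → ℤˣ) (x y : Fin n → ℝ), IsObliqueTrigon s ρ x y ∧
      X = obliqueCoord ⁻¹' ⋃ j, obliqueTriangle (ρ j) s (x j) (y j) := by
  obtain ⟨T, hT, hdisj, hconn, rfl⟩ := h
  choose hs ρ x y hv using fun i => (hT i).exists_obliqueVertices
  have hcl := fun i => closedInterior_eq_preimage (hs i) (hv i)
  have hdisj' : Pairwise (Function.onFun Disjoint
      fun j => openObliqueTriangle (ρ j) s (x j) (y j)) := by
    intro i j hij
    have hsub : ∀ i, obliqueCoord ⁻¹' openObliqueTriangle (ρ i) s (x i) (y i) ⊆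
        interior (T i).closedInterior := by
      intro i
      rw [hcl i]
      exact interior_maximal (Set.preimage_mono (openObliqueTriangle_subset _ _ _ _))
        ((isOpen_openObliqueTriangle _ _ _ _).preimage continuous_obliqueCoord)
    exact ((hdisj i j hij).mono (hsub i) (hsub j)).of_preimage obliqueCoord_surjective
  refine ⟨ρ, x, y, ⟨hdisj', ?_⟩, by simp only [hcl, Set.preimage_iUnion]⟩
  have hshare : ∀ i j, i ≠ j → ShareSide (T i) (T j) → SideAdjacent s ρ x y i j := by
    rintro i j hij ⟨p, q, hpq, hpi, hqi, hpj, hqj⟩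
    exact sideAdjacent_of_common_vertices (hs i) (hdisj' hij) (obliqueCoord_injective.ne hpq)
      (hv i ▸ Set.mem_image_of_mem _ hpi) (hv i ▸ Set.mem_image_of_mem _ hqi)
      (hv j ▸ Set.mem_image_of_mem _ hpj) (hv j ▸ Set.mem_image_of_mem _ hqj)
  obtain ⟨r⟩ := hconn.nonempty
  refine ⟨r, fun j => ?_⟩
  refine Relation.ReflTransGen.mono ?_ _ _
    ((SimpleGraph.reachable_iff_reflTransGen r j).1 (hconn.preconnected r j))
  rintro i j hij
  rw [SimpleGraph.fromRel_adj] at hij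
  obtain ⟨hne, h | ⟨p, q, hpq, h1, h2, h3, h4⟩⟩ := hij
  · exact hshare i j hne h
  · exact hshare i j hne ⟨p, q, hpq, h3, h4, h1, h2⟩

theorem mainTheorem3 (n : ℕ) (hn : 1 ≤ n) :
    (∃ ε₀ : ℝ, 0 < ε₀ ∧ ∀ ε : ℝ, 0 < ε → ε < ε₀ →
      ∀ T : Affine.Triangle ℝ Plane, IsEquilateralHTriangle ((n : ℝ) + ε) T →
        IsUnitCoverNumber T.closedInterior (n ^ 2 + 2)) ∧
    (∃ ε₀ : ℝ, 0 < ε₀ ∧ ∀ ε : ℝ, 0 < ε → ε < ε₀ →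
      ∀ X : Set Plane, IsTrigon n (1 + ε) X →
        IsUnitCoverNumber X (n + 2)) := by
  have bound : ∀ (N : ℕ) (e : ℝ), e < 1 / (2 * (3 * 2 ^ N)) → e * (3 * 2 ^ N) ≤ 1 / 2 := by
    intro N e he
    rw [lt_div_iff₀ (by positivity)] at he
    linarith
  have hn0 : (1 : ℝ) ≤ n := by exact_mod_cast hn
  constructor
  -- The cells have side `1 + ε / n` and `ε / n ≤ ε`, so the threshold for a trigon of `n ^ 2`
  -- triangles suffices.
  · refine ⟨1 / (2 * (3 * 2 ^ (n ^ 2))), by positivity, fun ε hε hε' T hT => ?_⟩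
    obtain ⟨hs, σ, x, y, hv⟩ := hT.exists_obliqueVertices
    have hcard : Fintype.card (Fin n × Fin n) = n ^ 2 := by simp [sq]
    have hside : (n : ℝ) + ε = n * (1 + ε / n) := by field_simp
    have hle : ε / n ≤ ε := div_le_self hε.le hn0
    have hpos : 0 < ε / n := by positivity
    rw [closedInterior_eq_preimage hs hv, hside, ← iUnion_grid hn (by linarith) σ x y, ← hcard]
    exact (isObliqueTrigon_grid hn (by linarith) σ x y).isUnitCoverNumber hpos
      (by rw [hcard]; exact bound _ _ (by linarith))
  · refine ⟨1 / (2 * (3 * 2 ^ n)), by positivity, fun ε hε hε' X hX => ?_⟩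
    obtain ⟨ρ, x, y, h, rfl⟩ := hX.exists_isObliqueTrigon
    have := h.isUnitCoverNumber hε (by rw [Fintype.card_fin]; exact bound _ _ hε')
    rwa [Fintype.card_fin] at this
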